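/- Consider the problem $$\min_{x\in\mathbb R^n} r(x)\quad\text{s.t.}\quad c(x)=0,\ \ 0\le x\le x_u,\tag{P}$$ with $x_u\in\mathbb R^n$, $x_u>0$ componentwise, and $c:\mathbb R^n\to\mathbb R^m$ continuously differentiable. Assume that the feasible set $F=\{x: c(x)=0,\ 0\le x\le x_u\}$ is convex and bounded, and that $r$ is locally Lipschitz and upper-$C^2$ on an open set $O\supseteq F$. Here upper-$C^2$ means that for each $\bar x\in O$ there is $\rho_0>0$ such that for every $\rho>\rho_0$ the function $-r+\frac{\rho}{2}\|\cdot\|^2$ is convex on a convex open neighbourhood of $\bar x$. Let $\bar\partial r$ be the Clarke subdifferential. **Algorithm (simplified bundle method without linearization and without line search).** Parameters: $\alpha_0>0$, $\epsilon\ge0$, $0<\eta_l^+\le1\le\eta_l^-$, $0<\eta_\gamma^+\le1\le\eta_\gamma^-$, $\eta_\alpha>1$; starting point $x_0\in O$ (not necessarily feasible). At iteration $k=0,1,2,\dots$: 1. choose any $g_k\in\bar\partial r(x_k)$, put $\phi_k(x)=r(x_k)+g_k^T(x-x_k)+\frac{\alpha_k}{2}\|x-x_k\|^2$, and let $x_k+d_k$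 be a minimizer of $\phi_k$ over the original constraints $c(x)=0$, $0\le x\le x_u$; 2. stop if $\|d_k\|\le\epsilon$; 3. put $\delta_k=\phi_k(x_k)-\phi_k(x_k+d_k)$ and $\rho_k=r(x_k)-r(x_k+d_k)-\eta_l^{\pm}\delta_k$, $\rho_k^1=r(x_k)-r(x_k+d_k)-\eta_\gamma^{\pm}\delta_k$, with the sign $+$ if $\delta_k\ge0$ and $-$ if $\delta_k<0$. If $\rho_k>0$ and $\rho_k^1\ge0$, take the full (serious) step $x_{k+1}=x_k+d_k$, $\alpha_{k+1}=\alpha_k$. Otherwise reject: $x_{k+1}=x_k$, $\alpha_{k+1}=\eta_\alpha\alpha_k$. A KKT point of (P) is a point $\bar x\in F$ for which there are $\bar g\in\bar\partial r(\bar x)$, $\bar\lambda\in\mathbb R^m$ and $\bar\zeta_l,\bar\zeta_u\in\mathbb R^n_{\ge0}$ with $$\bar g-\nabla c(\bar x)\bar\lambda-\bar\zeta_l+\bar\zeta_u=0,\qquad (\bar\zeta_l)_i\,\bar x_i=0,\quad(\bar\zeta_u)_i\,(\bar x-x_u)_i=0\quad\text{for all }i.$$ Multipliers of the $k$-th subproblem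 are $(\lambda,\zeta_l,\zeta_u)$ satisfying the same conditions with $x_k+d_k$ in place of $\bar x$ and $g_k+\alpha_kd_k$ in place of $\bar g$. LICQ holds at $x$ if the vectors $\nabla c_j(x)$ $(1\le j\le m)$ and $e_i$ ($x_i=0$ or $x_i=(x_u)_i$) are linearly independent. **Proposition.** If $F\neq\emptyset$, every subproblem (for any centre, any vector $g$ and any $\alpha>0$) has exactly one solution. For every run of the algorithm: * All iterates after the first serious step are feasible. * There is $c_\phi>0$ such that at every serious step from a feasible $x_k$, and for every $\theta\in\mathbb R$, the merit function $\phi_{1\theta}(x)=r(x)+\theta\|c(x)\|_1$ satisfies $\phi_{1\theta}(x_k)-\phi_{1\theta}(x_{k+1})>c_\phi\|d_k\|^2$. * If the algorithm stops at iteration $k$ with $d_k=0$, and LICQ holds at $x_k$ or the $k$-th subproblem has multipliers, then $x_k$ is a KKT point of (P). * If $\epsilon>0$, the algorithm stops after finitely many iterations. * If the algorithm does not stop, then only finitely many steps are rejected, $\alpha_k$ is eventually constant, $d_k\to0$, and $\{x_k\}$ has an accumulation point. If moreover LICQ holds at every accumulation point of $\{x_k\}$, then: for all large $k$ the subproblem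 has multipliers, and all multipliers of these subproblems are bounded by one constant; for any $\gamma\in\mathbb R$ and any choice, for all large $k$, of multipliers $(\lambda^{k+1},\zeta_l^{k+1},\zeta_u^{k+1})$ of the $k$-th subproblem, every real sequence satisfying $\theta_k=\max\{\theta_{k-1},\eta_\gamma^-\|\lambda^{k+1}\|_\infty+\gamma\}$ for all large $k$ converges; and every accumulation point of $\{x_k\}$ is a KKT point of (P). -/

import Mathlib

open Filter Topology Set

namespace SimplifiedBundle

/-- `ℝⁿ` with the Euclidean norm and inner product. -/
abbrev Vec (n : ℕ) := EuclideanSpace ℝ (Fin n)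

section Nonsmooth

variable {n : ℕ}

/-- Clarke's generalized directional derivative
`r°(x; v) = limsup_{y → x, t ↓ 0} (r (y + t v) - r y) / t`
(the difference quotients are bounded near `x` when `r` is Lipschitz near `x`). -/
noncomputable def clarkeDeriv (r : Vec n → ℝ) (x v : Vec n) : ℝ :=
  limsup (fun p : Vec n × ℝ => (r (p.1 + p.2 • v) - r p.1) / p.2) (𝓝 x ×ˢ 𝓝[>] (0 : ℝ))

/-- The Clarke subdifferential `{g | ⟨g, v⟩ ≤ r°(x; v) for all v}`. -/
def clarkeSubdiff (r : Vec n → ℝ) (x : Vec n) : Set (Vec n) :=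
  {g | ∀ v : Vec n, inner ℝ g v ≤ clarkeDeriv r x v}

/-- `h` is lower-`C²` on `O`: around each point of `O` there is a threshold `ρ₀ > 0` such that
`h + (ρ / 2) ‖·‖²` is convex on an open (convex) neighbourhood of the point whenever `ρ > ρ₀`. -/
def LowerC2On (h : Vec n → ℝ) (O : Set (Vec n)) : Prop :=
  ∀ x ∈ O, ∃ ρ₀ : ℝ, 0 < ρ₀ ∧ ∀ ρ : ℝ, ρ₀ < ρ → ∃ V : Set (Vec n), IsOpen V ∧ x ∈ V ∧
    ConvexOn ℝ V (fun y => h y + ρ / 2 * ‖y‖ ^ 2)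

/-- `r` is upper-`C²` on `O` when `-r` is lower-`C²` on `O`. -/
def UpperC2On (r : Vec n → ℝ) (O : Set (Vec n)) : Prop :=
  LowerC2On (fun y => -r y) O

end Nonsmooth

/-- The data of the problem: minimize `r x` subject to `c x = 0`, `0 ≤ x ≤ xu`. -/
structure Problem (n m : ℕ) where
  /-- the objective -/
  r : Vec n → ℝ
  /-- the equality constraints -/
  c : Vec n → Fin m → ℝ
  /-- the upper bounds -/
  xu : Vec n

namespace Problem

variable {n m : ℕ} (P : Problem n m)

/-- The feasible set, cut out by the equality constraints and the bounds. -/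
def feasible : Set (Vec n) :=
  {x | P.c x = 0 ∧ ∀ i, 0 ≤ x i ∧ x i ≤ P.xu i}

/-- The gradient of the `j`-th equality constraint. -/
noncomputable def gradC (x : Vec n) (j : Fin m) : Vec n :=
  gradient (fun y => P.c y j) x

/-- The `ℓ₁` merit function `r x + θ ‖c x‖₁`. -/
noncomputable def merit (θ : ℝ) (x : Vec n) : ℝ :=
  P.r x + θ * ∑ j, |P.c x j|

/-- Linear independence constraint qualification at `x`: the gradients of the equality constraints
and the coordinate vectors of the active bounds are linearly independent. -/
def LICQ (x : Vec n) : Prop :=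
  LinearIndependent ℝ
    (Sum.elim (fun j : Fin m => P.gradC x j)
      (fun i : {i : Fin n // x i = 0 ∨ x i = P.xu i} =>
        (EuclideanSpace.single (i : Fin n) (1 : ℝ) : Vec n)))

/-- `lam, zl, zu` are Lagrange multipliers at the feasible point `y` for an objective whose
(sub)gradient there is `v`: stationarity, complementarity, and sign conditions. -/
def IsMultiplier (v y : Vec n) (lam : Fin m → ℝ) (zl zu : Vec n) : Prop :=
  y ∈ P.feasible ∧
  v - ∑ j, lam j • P.gradC y j - zl + zu = 0 ∧
  (∀ i, 0 ≤ zl i ∧ 0 ≤ zu i) ∧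
  (∀ i, zl i * y i = 0 ∧ zu i * (y i - P.xu i) = 0)

/-- `x` is a KKT point of the problem, in the sense of Clarke subgradients. -/
def IsKKT (x : Vec n) : Prop :=
  ∃ g ∈ clarkeSubdiff P.r x, ∃ (lam : Fin m → ℝ) (zl zu : Vec n), P.IsMultiplier g x lam zl zu

/-- The quadratic model `φ(y) = r z + ⟨g, y - z⟩ + (a / 2) ‖y - z‖²` around `z`. -/
noncomputable def model (z g : Vec n) (a : ℝ) (y : Vec n) : ℝ :=
  P.r z + inner ℝ g (y - z) + a / 2 * ‖y - z‖ ^ 2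

/-- `z + d` solves the subproblem: minimize the model over the original constraints
`c y = 0`, `0 ≤ y ≤ xu` (no linearization). -/
def SolvesSubproblem (z g : Vec n) (a : ℝ) (d : Vec n) : Prop :=
  z + d ∈ P.feasible ∧ IsMinOn (P.model z g a) P.feasible (z + d)

/-- Multipliers of the subproblem at its solution `z + d`; the gradient of the model there is
`g + a d`. -/
def IsSubproblemMultiplier (z g : Vec n) (a : ℝ) (d : Vec n)
    (lam : Fin m → ℝ) (zl zu : Vec n) : Prop :=
  P.IsMultiplier (g + a • d) (z + d) lam zl zu

/-- The predicted change `δ = φ(z) - φ(z + d)`. -/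
noncomputable def predicted (z g : Vec n) (a : ℝ) (d : Vec n) : ℝ :=
  P.model z g a z - P.model z g a (z + d)

/-- The ratio `r z - r (z + d) - η δ`, where `η = ηp` if `δ ≥ 0` and `η = ηm` if `δ < 0`. -/
noncomputable def ratio (ηp ηm : ℝ) (z g : Vec n) (a : ℝ) (d : Vec n) : ℝ :=
  P.r z - P.r (z + d) -
    (if 0 ≤ P.predicted z g a d then ηp else ηm) * P.predicted z g a d

end Problem

/-- The parameters of the algorithm. Those of the line search are absent. -/
structure Params where
  /-- initial quadratic coefficient `α₀` -/
  alpha0 : ℝ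
  /-- stopping tolerance `ε` -/
  eps : ℝ
  /-- `η_l⁺` -/
  etaLp : ℝ
  /-- `η_l⁻` -/
  etaLm : ℝ
  /-- `η_γ⁺` -/
  etaGp : ℝ
  /-- `η_γ⁻` -/
  etaGm : ℝ
  /-- `η_α` -/
  etaA : ℝ
  alpha0_pos : 0 < alpha0
  eps_nonneg : 0 ≤ eps
  etaLp_pos : 0 < etaLp
  etaLp_le : etaLp ≤ 1
  etaLm_ge : 1 ≤ etaLm
  etaGp_pos : 0 < etaGp
  etaGp_le : etaGp ≤ 1
  etaGm_ge : 1 ≤ etaGm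
  etaA_gt : 1 < etaA

/-- The trial step `d` at `z` is accepted: `ρ > 0`, and the second test, evaluated at the full
step `z + d`, does not fail. -/
def Accepted {n m : ℕ} (P : Problem n m) (A : Params) (z g : Vec n) (a : ℝ) (d : Vec n) : Prop :=
  0 < P.ratio A.etaLp A.etaLm z g a d ∧ ¬ P.ratio A.etaGp A.etaGm z g a d < 0

/-- A run of the simplified bundle method without linearization and without line search.
`N` is the iteration at which the stopping test succeeds, `N = ⊤` if it never does. At iteration
`k ≤ N`, `x k` is the current iterate, `g k` a Clarke subgradient, `α k` the quadratic
coefficient and `d k` the step solving the subproblem. -/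
structure IsRun {n m : ℕ} (P : Problem n m) (A : Params) (N : ℕ∞)
    (x g d : ℕ → Vec n) (α : ℕ → ℝ) : Prop where
  init : α 0 = A.alpha0
  subgrad : ∀ k : ℕ, (k : ℕ∞) ≤ N → g k ∈ clarkeSubdiff P.r (x k)
  solves : ∀ k : ℕ, (k : ℕ∞) ≤ N → P.SolvesSubproblem (x k) (g k) (α k) (d k)
  halts : ∀ k : ℕ, (k : ℕ∞) = N → ‖d k‖ ≤ A.eps
  proceed : ∀ k : ℕ, (k : ℕ∞) < N → A.eps < ‖d k‖
  serious : ∀ k : ℕ, (k : ℕ∞) < N → Accepted P A (x k) (g k) (α k) (d k) →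
    x (k + 1) = x k + d k ∧ α (k + 1) = α k
  reject : ∀ k : ℕ, (k : ℕ∞) < N → ¬ Accepted P A (x k) (g k) (α k) (d k) →
    x (k + 1) = x k ∧ α (k + 1) = A.etaA * α k

end SimplifiedBundle

/-! Upper-`C²` regularity supplies the driving inequality: one constant `R` with `r y ≤ r x + ⟨g, y
- x⟩ + R/2 ‖y - x‖²` for all `x, y` in the compact feasible set `F` and all Clarke subgradients `g`
at `x` (`exists_uniform_quadratic_bound`). Since `F` is convex, comparing the subproblem's solution
with a feasible centre gives `δ ≥ α/2 ‖d‖²`. So a nonzero step from a feasible centre is accepted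
once `α > R`, and every accepted one lowers `r` by more than a fixed multiple of `‖d‖²`. Only `x 0`
can be an infeasible centre; there `‖d‖` is bounded below, so `δ → -∞` as `α` grows, and the step is
accepted as well (`exists_accepted_of_not_feasible`).

Each rejection multiplies `α` by `η_α > 1`, so an infinite run rejects only finitely often.
Telescoping the decrease, with `r` bounded on `F`, gives `d → 0`, which a positive tolerance rules
out.

The subproblem's solution satisfies a variational inequality over `F`. Under LICQ the curves of
`exists_curve` make every linearized feasible direction tangent to `F`, which turns the inequality
into multipliers (`exists_multiplier_of_LICQ`). LICQ is an open condition and bounds nearby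
multipliers by the size of the gradient (`LICQ.exists_multiplier_bound`); by compactness they are
bounded along the tail of the run. Running maxima built from them therefore converge, and the
subproblem's optimality conditions pass to the limit because the Clarke subdifferential has closed
graph (`mem_clarkeSubdiff_of_tendsto`). -/

namespace SimplifiedBundle

/-! ### Clarke subgradients of locally Lipschitz and upper-`C²` functions. -/

section Clarke

variable {n : ℕ} {r : Vec n → ℝ} {x v g : Vec n}

theorem eventually_mem_add_smul {U : Set (Vec n)} (hU : U ∈ 𝓝 x) (v : Vec n) :
    ∀ᶠ p : Vec n × ℝ in 𝓝 x ×ˢ 𝓝[>] (0 : ℝ), p.1 + p.2 • v ∈ U := by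
  have h : Tendsto (fun p : Vec n × ℝ => p.1 + p.2 • v) (𝓝 x ×ˢ 𝓝[>] (0 : ℝ)) (𝓝 x) := by
    have hc : Continuous (fun p : Vec n × ℝ => p.1 + p.2 • v) := by fun_prop
    have h0 := hc.tendsto (x, 0)
    simp only [zero_smul, add_zero] at h0
    refine h0.mono_left ?_
    rw [nhds_prod_eq]
    exact Filter.prod_mono le_rfl nhdsWithin_le_nhds
  exact h hU

theorem eventually_snd_pos :
    ∀ᶠ p : Vec n × ℝ in 𝓝 x ×ˢ 𝓝[>] (0 : ℝ), 0 < p.2 :=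
  tendsto_snd.eventually (eventually_mem_nhdsWithin (a := (0 : ℝ)) (s := Ioi 0))

theorem eventually_abs_quotient_le {K : NNReal} {U : Set (Vec n)} (hU : U ∈ 𝓝 x)
    (hK : LipschitzOnWith K r U) (v : Vec n) :
    ∀ᶠ p : Vec n × ℝ in 𝓝 x ×ˢ 𝓝[>] (0 : ℝ),
      |(r (p.1 + p.2 • v) - r p.1) / p.2| ≤ K * ‖v‖ := by
  filter_upwards [eventually_mem_add_smul hU v, tendsto_fst.eventually hU, eventually_snd_pos]
    with p h1 h2 h3
  have h := hK.dist_le_mul _ h1 _ h2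
  rw [Real.dist_eq, dist_eq_norm, add_sub_cancel_left, norm_smul, Real.norm_eq_abs,
    abs_of_pos h3] at h
  rw [abs_div, abs_of_pos h3, div_le_iff₀ h3]
  linarith

/-- A real `limsup` is meaningful only for bounded functions; the Lipschitz estimate supplies the
lower bound on the quotients needed here. -/
theorem clarkeDeriv_le {K : NNReal} {U : Set (Vec n)} (hU : U ∈ 𝓝 x)
    (hK : LipschitzOnWith K r U) {a : ℝ}
    (h : ∀ᶠ p : Vec n × ℝ in 𝓝 x ×ˢ 𝓝[>] (0 : ℝ), (r (p.1 + p.2 • v) - r p.1) / p.2 ≤ a) :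
    clarkeDeriv r x v ≤ a := by
  refine limsup_le_of_le ?_ h
  refine IsBoundedUnder.isCoboundedUnder_le ⟨-(K * ‖v‖), ?_⟩
  rw [eventually_map]
  filter_upwards [eventually_abs_quotient_le hU hK v] with p hp
  exact (abs_le.1 hp).1

theorem eventually_quotient_lt {K : NNReal} {U : Set (Vec n)} (hU : U ∈ 𝓝 x)
    (hK : LipschitzOnWith K r U) {a : ℝ} (h : clarkeDeriv r x v < a) :
    ∀ᶠ p : Vec n × ℝ in 𝓝 x ×ˢ 𝓝[>] (0 : ℝ), (r (p.1 + p.2 • v) - r p.1) / p.2 < a := by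
  refine eventually_lt_of_limsup_lt h ⟨K * ‖v‖, ?_⟩
  rw [eventually_map]
  filter_upwards [eventually_abs_quotient_le hU hK v] with p hp
  exact (abs_le.1 hp).2

/-- The subgradient is tested in its own direction: `‖g‖² ≤ r°(x; g) ≤ K ‖g‖`. -/
theorem norm_le_of_mem_clarkeSubdiff {K : NNReal} {U : Set (Vec n)} (hU : U ∈ 𝓝 x)
    (hK : LipschitzOnWith K r U) (hg : g ∈ clarkeSubdiff r x) : ‖g‖ ≤ K := by
  have h1 := hg g
  have h2 : clarkeDeriv r x g ≤ K * ‖g‖ := by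
    refine clarkeDeriv_le hU hK ?_
    filter_upwards [eventually_abs_quotient_le hU hK g] with p hp
    exact (abs_le.1 hp).2
  rw [real_inner_self_eq_norm_sq] at h1
  rcases (norm_nonneg g).eq_or_lt with h0 | h0
  · rw [← h0]; exact K.2
  · nlinarith

/-- Upper semicontinuity in the base point: a bound on the quotients for all base points near `x` is
also a bound near each point close to `x`. -/
theorem eventually_clarkeDeriv_le {K : NNReal} {U : Set (Vec n)} (hU : U ∈ 𝓝 x)
    (hK : LipschitzOnWith K r U) {a : ℝ} (h : clarkeDeriv r x v < a) :
    ∀ᶠ y in 𝓝 x, clarkeDeriv r y v ≤ a := by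
  obtain ⟨pa, hpa, pb, hpb, hp⟩ := eventually_prod_iff.1 (eventually_quotient_lt hU hK h)
  filter_upwards [eventually_eventually_nhds.2 hpa, eventually_eventually_nhds.2 hU]
    with y hy hyU
  refine clarkeDeriv_le hyU hK ?_
  exact eventually_prod_iff.2 ⟨pa, hy, pb, hpb, fun h1 _ h2 => (hp h1 h2).le⟩

/-- The graph of the Clarke subdifferential is closed. -/
theorem mem_clarkeSubdiff_of_tendsto {ι : Type*} {l : Filter ι} [l.NeBot] {K : NNReal}
    {U : Set (Vec n)} (hU : U ∈ 𝓝 x) (hK : LipschitzOnWith K r U) {xs gs : ι → Vec n}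
    (hx : Tendsto xs l (𝓝 x)) (hg : Tendsto gs l (𝓝 g))
    (h : ∀ᶠ k in l, gs k ∈ clarkeSubdiff r (xs k)) : g ∈ clarkeSubdiff r x := by
  intro v
  refine le_of_forall_gt_imp_ge_of_dense fun a ha => ?_
  refine le_of_tendsto (hg.inner tendsto_const_nhds) ?_
  filter_upwards [h, hx.eventually (eventually_clarkeDeriv_le hU hK ha)] with k h1 h2
  exact (h1 v).trans h2

/-- Quadratic upper bound at Clarke subgradients of a function `r` for which
`-r + (ρ / 2) ‖·‖²` is convex. -/
theorem le_quadratic_of_mem_clarkeSubdiff {K : NNReal} {U V : Set (Vec n)} (hU : U ∈ 𝓝 x)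
    (hK : LipschitzOnWith K r U) (hV : IsOpen V) {ρ : ℝ}
    (hconv : ConvexOn ℝ V (fun y => -r y + ρ / 2 * ‖y‖ ^ 2)) (hx : x ∈ V)
    (hg : g ∈ clarkeSubdiff r x) {y : Vec n} (hy : y ∈ V) :
    r y ≤ r x + inner ℝ g (y - x) + ρ / 2 * ‖y - x‖ ^ 2 := by
  set h : Vec n → ℝ := fun y => -r y + ρ / 2 * ‖y‖ ^ 2 with hh
  have hcont : ContinuousOn h V := hconv.continuousOn hV
  -- The direction points away from `y`, so that a base point `z` near `x` lies between `z - v`,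
  -- which is near `y`, and `z + t • v`.
  set v := x - y with hv
  have hmain : clarkeDeriv r x v ≤ h y - h x + ρ * inner ℝ x v := by
    refine le_of_forall_gt_imp_ge_of_dense fun a ha => ?_
    refine clarkeDeriv_le hU hK ?_
    have hlim : Tendsto (fun p : Vec n × ℝ =>
        h (p.1 - v) - h p.1 + ρ * inner ℝ p.1 v + ρ / 2 * (p.2 * ‖v‖ ^ 2))
        (𝓝 x ×ˢ 𝓝[>] (0 : ℝ)) (𝓝 (h y - h x + ρ * inner ℝ x v)) := by
      have e1 : Tendsto (fun p : Vec n × ℝ => p.1) (𝓝 x ×ˢ 𝓝[>] (0 : ℝ)) (𝓝 x) := tendsto_fst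
      have e2 : Tendsto (fun p : Vec n × ℝ => p.2) (𝓝 x ×ˢ 𝓝[>] (0 : ℝ)) (𝓝 0) :=
        tendsto_snd.mono_right nhdsWithin_le_nhds
      have e3 : Tendsto (fun p : Vec n × ℝ => h p.1) (𝓝 x ×ˢ 𝓝[>] (0 : ℝ)) (𝓝 (h x)) :=
        ((hcont.continuousAt (hV.mem_nhds hx)).tendsto).comp e1
      have e4 : Tendsto (fun p : Vec n × ℝ => p.1 - v) (𝓝 x ×ˢ 𝓝[>] (0 : ℝ)) (𝓝 y) := by
        have := e1.sub_const v
        rwa [hv, sub_sub_cancel] at this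
      have e5 : Tendsto (fun p : Vec n × ℝ => h (p.1 - v)) (𝓝 x ×ˢ 𝓝[>] (0 : ℝ)) (𝓝 (h y)) :=
        ((hcont.continuousAt (hV.mem_nhds hy)).tendsto).comp e4
      have e6 : Tendsto (fun p : Vec n × ℝ => (inner ℝ p.1 v : ℝ)) (𝓝 x ×ˢ 𝓝[>] (0 : ℝ))
          (𝓝 (inner ℝ x v)) := e1.inner tendsto_const_nhds
      have := ((e5.sub e3).add (e6.const_mul ρ)).add ((e2.mul_const (‖v‖ ^ 2)).const_mul (ρ / 2))
      simpa using this
    have hyv : ∀ᶠ p : Vec n × ℝ in 𝓝 x ×ˢ 𝓝[>] (0 : ℝ), p.1 - v ∈ V := by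
      have e4 : Tendsto (fun p : Vec n × ℝ => p.1 - v) (𝓝 x ×ˢ 𝓝[>] (0 : ℝ)) (𝓝 y) := by
        have := (tendsto_fst (f := 𝓝 x) (g := 𝓝[>] (0 : ℝ))).sub_const v
        rwa [hv, sub_sub_cancel] at this
      exact e4 (hV.mem_nhds hy)
    filter_upwards [hlim.eventually (gt_mem_nhds ha), hyv,
      eventually_mem_add_smul (hV.mem_nhds hx) v, tendsto_fst.eventually (hV.mem_nhds hx),
      eventually_snd_pos] with p h1 h2 h3 h4 ht
    refine le_trans ?_ h1.le
    obtain ⟨z, t⟩ := p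
    simp only at h1 h2 h3 h4 ht ⊢
    -- Convexity at `z`, with weights `t/(1+t)` and `1/(1+t)`, bounds `h z - h (z + t • v)` by `t (h
    -- (z - v) - h z)`. Up to the quadratic term this is the increment of `r`.
    have hcx := hconv.2 h2 h3 (show 0 ≤ t / (1 + t) by positivity)
      (show 0 ≤ 1 / (1 + t) by positivity) (by field_simp; ring)
    have hz : (t / (1 + t)) • (z - v) + (1 / (1 + t)) • (z + t • v) = z := by
      have h1t : (1 + t) ≠ 0 := by positivity
      rw [smul_sub, smul_add, smul_smul]
      have e : (1 / (1 + t)) * t = t / (1 + t) := by ring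
      rw [e]
      have e' : (t / (1 + t)) • z + (1 / (1 + t)) • z = z := by
        rw [← add_smul]
        have : t / (1 + t) + 1 / (1 + t) = 1 := by field_simp; ring
        rw [this, one_smul]
      calc _ = (t / (1 + t)) • z + (1 / (1 + t)) • z := by abel
        _ = z := e'
    rw [hz, smul_eq_mul, smul_eq_mul] at hcx
    have hcx' : h z * (1 + t) ≤ t * h (z - v) + h (z + t • v) := by
      have h1t : (0 : ℝ) < 1 + t := by positivity
      calc h z * (1 + t) ≤ (t / (1 + t) * h (z - v) + 1 / (1 + t) * h (z + t • v)) * (1 + t) :=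
            mul_le_mul_of_nonneg_right hcx h1t.le
        _ = _ := by field_simp
    have hn : ‖z + t • v‖ ^ 2 = ‖z‖ ^ 2 + 2 * (t * inner ℝ z v) + t ^ 2 * ‖v‖ ^ 2 := by
      rw [norm_add_sq_real, inner_smul_right, norm_smul, mul_pow, Real.norm_eq_abs, sq_abs]
    rw [div_le_iff₀ ht]
    have e1 : r (z + t • v) = ρ / 2 * ‖z + t • v‖ ^ 2 - h (z + t • v) := by simp [hh]
    have e2 : r z = ρ / 2 * ‖z‖ ^ 2 - h z := by simp [hh]
    rw [e1, e2, hn]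
    nlinarith
  have hgv := (hg v).trans hmain
  have hn : ‖y‖ ^ 2 = ‖x‖ ^ 2 - 2 * inner ℝ x v + ‖v‖ ^ 2 := by
    rw [← norm_sub_sq_real, hv, sub_sub_cancel]
  have e1 : (inner ℝ g (y - x) : ℝ) = - inner ℝ g v := by
    rw [hv, ← inner_neg_right, neg_sub]
  have e2 : ‖y - x‖ = ‖v‖ := norm_sub_rev _ _
  rw [e1, e2]
  simp only [hh, hn] at hgv
  linarith

/-- On a compact subset of an open set where `r` is locally Lipschitz and upper-`C²`, the Clarke
subgradients satisfy a quadratic upper bound with a uniform constant. -/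
theorem exists_uniform_quadratic_bound {O F : Set (Vec n)} (hO : IsOpen O) (hFO : F ⊆ O)
    (hF : IsCompact F) (hLip : LocallyLipschitzOn O r) (hC2 : UpperC2On r O) :
    ∃ R : ℝ, ∀ x ∈ F, ∀ y ∈ F, ∀ g ∈ clarkeSubdiff r x,
      r y ≤ r x + inner ℝ g (y - x) + R / 2 * ‖y - x‖ ^ 2 := by
  have key : ∃ R : ℝ, ∀ p ∈ F ×ˢ F, ∀ g ∈ clarkeSubdiff r p.1,
      r p.2 ≤ r p.1 + inner ℝ g (p.2 - p.1) + R / 2 * ‖p.2 - p.1‖ ^ 2 := by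
    refine (hF.prod hF).induction_on
      (p := fun S => ∃ R : ℝ, ∀ p ∈ S, ∀ g ∈ clarkeSubdiff r p.1,
      r p.2 ≤ r p.1 + inner ℝ g (p.2 - p.1) + R / 2 * ‖p.2 - p.1‖ ^ 2) ⟨0, by simp⟩ ?_ ?_ ?_
    · rintro s t hst ⟨R, hR⟩
      exact ⟨R, fun p hp => hR p (hst hp)⟩
    · rintro s t ⟨R, hR⟩ ⟨R', hR'⟩
      refine ⟨max R R', ?_⟩
      rintro p (hp | hp) g hg
      · refine (hR p hp g hg).trans ?_
        gcongr
        exact le_max_left _ _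
      · refine (hR' p hp g hg).trans ?_
        gcongr
        exact le_max_right _ _
    · rintro ⟨a, b⟩ ⟨ha, hb⟩
      simp only at ha hb
      obtain ⟨K, U, hU, hK⟩ := hLip (hFO ha)
      obtain ⟨K', U', hU', hK'⟩ := hLip (hFO hb)
      rw [hO.nhdsWithin_eq (hFO ha)] at hU
      rw [hO.nhdsWithin_eq (hFO hb)] at hU'
      -- Near the diagonal local convexity gives the constant. Away from it `‖y - x‖` is at least
      -- `‖b - a‖ / 2`, so a sufficiently large quadratic term absorbs any bounded error.
      by_cases hab : a = b
      · subst hab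
        obtain ⟨ρ₀, -, h⟩ := hC2 a (hFO ha)
        obtain ⟨V, hV, haV, hconv⟩ := h (ρ₀ + 1) (by linarith)
        have hn : (interior U ∩ V) ×ˢ V ∈ 𝓝 (a, a) :=
          prod_mem_nhds (Filter.inter_mem (interior_mem_nhds.2 hU) (hV.mem_nhds haV))
            (hV.mem_nhds haV)
        refine ⟨_, mem_nhdsWithin_of_mem_nhds hn, ρ₀ + 1, ?_⟩
        rintro ⟨x, y⟩ ⟨hx, hy⟩ g hg
        exact le_quadratic_of_mem_clarkeSubdiff (mem_interior_iff_mem_nhds.1 hx.1) hK hV hconv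
          hx.2 hg hy
      · have hpos : 0 < ‖b - a‖ := norm_pos_iff.2 (sub_ne_zero.2 (Ne.symm hab))
        have hca : ContinuousAt r a := (hK.continuousOn).continuousAt hU
        have hcb : ContinuousAt r b := (hK'.continuousOn).continuousAt hU'
        have hf : ContinuousAt (fun p : Vec n × Vec n => ‖p.2 - p.1‖) (a, b) := by fun_prop
        have hr1 : ContinuousAt (fun p : Vec n × Vec n => r p.1) (a, b) :=
          ContinuousAt.comp (f := Prod.fst) hca continuousAt_fst
        have hr2 : ContinuousAt (fun p : Vec n × Vec n => r p.2) (a, b) :=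
          ContinuousAt.comp (f := Prod.snd) hcb continuousAt_snd
        have hev : ∀ᶠ p : Vec n × Vec n in 𝓝 (a, b), ‖b - a‖ / 2 < ‖p.2 - p.1‖ ∧
            ‖p.2 - p.1‖ < ‖b - a‖ + 1 ∧ r p.2 - r p.1 < r b - r a + 1 ∧ U ∈ 𝓝 p.1 := by
          refine (hf.eventually (lt_mem_nhds (half_lt_self hpos))).and
            ((hf.eventually (gt_mem_nhds (lt_add_one _))).and
            (((hr2.sub hr1).eventually (gt_mem_nhds (lt_add_one _))).and ?_))
          have hUU : ∀ᶠ q in 𝓝 a, U ∈ 𝓝 q := eventually_eventually_nhds.2 hU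
          exact (continuous_fst.tendsto (a, b)).eventually hUU
        refine ⟨_, mem_nhdsWithin_of_mem_nhds hev,
          2 * ((|r b - r a| + 1 + K * (‖b - a‖ + 1)) / (‖b - a‖ / 2) ^ 2), ?_⟩
        rintro ⟨x, y⟩ ⟨h1, h2, h3, h4⟩ g hg
        simp only at h1 h2 h3 h4 ⊢
        have hgK := norm_le_of_mem_clarkeSubdiff h4 hK hg
        have hin : -(K * (‖b - a‖ + 1)) ≤ inner ℝ g (y - x) := by
          have := abs_real_inner_le_norm g (y - x)
          have h5 : ‖g‖ * ‖y - x‖ ≤ K * (‖b - a‖ + 1) := by gcongr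
          linarith [(abs_le.1 this).1]
        have hC : (0 : ℝ) ≤ |r b - r a| + 1 + K * (‖b - a‖ + 1) := by positivity
        have hq : |r b - r a| + 1 + K * (‖b - a‖ + 1) ≤
            (|r b - r a| + 1 + K * (‖b - a‖ + 1)) / (‖b - a‖ / 2) ^ 2 * ‖y - x‖ ^ 2 := by
          rw [div_mul_eq_mul_div, le_div_iff₀ (by positivity)]
          gcongr
        have := le_abs_self (r b - r a)
        linarith
  obtain ⟨R, hR⟩ := key
  exact ⟨R, fun x hx y hy g hg => hR (x, y) ⟨hx, hy⟩ g hg⟩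

end Clarke

/-! ### Biorthogonal families and curves through regular points. -/

section LinearAlgebra

variable {n : ℕ} {κ : Type*} [DecidableEq κ]

/-- A linearly independent family of vectors has a biorthogonal family. -/
theorem exists_biorthogonal {a : κ → Vec n} (ha : LinearIndependent ℝ a) :
    ∃ w : κ → Vec n, ∀ k l, (inner ℝ (a k) (w l) : ℝ) = if k = l then 1 else 0 := by
  have h : ∀ l, ∃ w : Vec n, ∀ k, (inner ℝ (a k) w : ℝ) = if k = l then 1 else 0 := by
    intro l
    -- The coordinate functional on the span is extended to the whole space and represented by a
    -- vector.
    obtain ⟨f, hf⟩ := LinearMap.exists_extend ((Module.Basis.span ha).coord l)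
    refine ⟨(InnerProductSpace.toDual ℝ (Vec n)).symm (LinearMap.toContinuousLinearMap f),
      fun k => ?_⟩
    rw [real_inner_comm, InnerProductSpace.toDual_symm_apply]
    have h1 := LinearMap.congr_fun hf ((Module.Basis.span ha) k)
    rw [Module.Basis.coord_apply, Module.Basis.repr_self, Finsupp.single_apply,
      LinearMap.comp_apply, Submodule.subtype_apply] at h1
    refine Eq.trans ?_ h1
    exact congrArg f (congrArg Subtype.val (Module.Basis.span_apply ha k)).symm
  choose w hw using h
  exact ⟨w, fun k l => hw l k⟩

/-- Through a regular point there are curves in every direction along which the components of the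
map are affine. -/
theorem exists_curve [Fintype κ] {G : Vec n → κ → ℝ} {x : Vec n} {a : κ → Vec n}
    (hG : ∀ k, HasStrictFDerivAt (fun y => G y k) (innerSL ℝ (a k)) x)
    {b : κ → Vec n} (hb : ∀ k l, (inner ℝ (a k) (b l) : ℝ) = if k = l then 1 else 0)
    (w : Vec n) :
    ∃ γ : ℝ → Vec n, HasDerivAt γ w 0 ∧ γ 0 = x ∧
      ∀ᶠ t in 𝓝 (0 : ℝ), ∀ k, G (γ t) k = G x k + t * inner ℝ (a k) w := by
  -- The correction along `b` has zero derivative at `x`, so `Φ` is locally invertible with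
  -- derivative the identity. By biorthogonality `⟨a k, Φ y⟩ = ⟨a k, x⟩ + G y k - G x k`, so `G` is
  -- affine along the preimage of the line `x + t • w`.
  set Φ : Vec n → Vec n := fun y =>
    y + ∑ l, (G y l - inner ℝ (a l) (y - x) - G x l) • b l with hΦ
  have hd : HasStrictFDerivAt Φ
      ((ContinuousLinearEquiv.refl ℝ (Vec n) : Vec n ≃L[ℝ] Vec n) : Vec n →L[ℝ] Vec n) x := by
    have h1 : ∀ l, HasStrictFDerivAt (fun y => (G y l - inner ℝ (a l) (y - x) - G x l) • b l)
        (0 : Vec n →L[ℝ] Vec n) x := by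
      intro l
      have h2 : HasStrictFDerivAt (fun y => (inner ℝ (a l) (y - x) : ℝ)) (innerSL ℝ (a l)) x :=
        (innerSL ℝ (a l)).hasStrictFDerivAt.comp x ((hasStrictFDerivAt_id x).sub_const x)
      have h3 := (((hG l).sub h2).sub_const (G x l)).smul_const (b l)
      simpa using h3
    have h4 := (hasStrictFDerivAt_id (𝕜 := ℝ) x).add
      (HasStrictFDerivAt.fun_sum (u := Finset.univ) fun l _ => h1 l)
    simp only [Finset.sum_const_zero, add_zero] at h4
    exact h4
  have hΦx : Φ x = x := by simp [hΦ]
  have hinner : ∀ y k, (inner ℝ (a k) (Φ y) : ℝ) = inner ℝ (a k) x + (G y k - G x k) := by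
    intro y k
    simp only [hΦ, inner_add_right, inner_sum, inner_smul_right, hb, inner_sub_right]
    simp
    ring
  have hline : HasDerivAt (fun t : ℝ => x + t • w) w 0 := by
    simpa using ((hasDerivAt_id (0 : ℝ)).smul_const w).const_add x
  refine ⟨fun t => hd.localInverse Φ _ x (x + t • w), ?_, ?_, ?_⟩
  · have h1 := hd.to_localInverse.hasFDerivAt
    have h2 : x + (0 : ℝ) • w = Φ x := by simp [hΦx]
    rw [← h2] at h1
    exact h1.comp_hasDerivAt (0 : ℝ) hline
  · have := hd.localInverse_apply_image
    rw [hΦx] at this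
    simpa using this
  · have hev := hd.eventually_right_inverse
    have ht : Tendsto (fun t : ℝ => x + t • w) (𝓝 0) (𝓝 (Φ x)) := by
      have := hline.continuousAt.tendsto
      simpa [hΦx] using this
    filter_upwards [ht.eventually hev] with t h k
    have h1 := hinner (hd.localInverse Φ _ x (x + t • w)) k
    rw [h, inner_add_right, inner_smul_right] at h1
    linarith

theorem norm_le_card_mul {z : Vec n} {B : ℝ} (h : ∀ i, |z i| ≤ B) : ‖z‖ ≤ n * B := by
  have hz : z = ∑ i, z i • EuclideanSpace.single i (1 : ℝ) := by
    ext j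
    simp [Finset.sum_apply, Pi.single_apply]
  rw [hz]
  refine (norm_sum_le _ _).trans ?_
  calc ∑ i, ‖z i • (EuclideanSpace.single i (1 : ℝ) : Vec n)‖ ≤ ∑ _i : Fin n, B := by
        refine Finset.sum_le_sum fun i _ => ?_
        rw [norm_smul, PiLp.norm_single]
        simpa using h i
    _ = n * B := by simp

end LinearAlgebra

/-! ### Multipliers under LICQ: existence, stability and bounds. -/

namespace Problem

variable {n m : ℕ} {P : Problem n m}

theorem contDiff_component (hc : ContDiff ℝ 1 P.c) (j : Fin m) :
    ContDiff ℝ 1 (fun y => P.c y j) :=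
  contDiff_pi.1 hc j

theorem innerSL_gradC (x : Vec n) (j : Fin m) :
    innerSL ℝ (P.gradC x j) = fderiv ℝ (fun y => P.c y j) x := by
  ext w
  simp [gradC, gradient]

theorem continuous_gradC (hc : ContDiff ℝ 1 P.c) (j : Fin m) :
    Continuous (fun x => P.gradC x j) :=
  (InnerProductSpace.toDual ℝ (Vec n)).symm.continuous.comp
    ((contDiff_component hc j).continuous_fderiv one_ne_zero)

/-- The constraint gradients that enter the constraint qualification at `x`. -/
noncomputable abbrev activeGrad (P : Problem n m) (x y : Vec n) :
    Fin m ⊕ {i : Fin n // x i = 0 ∨ x i = P.xu i} → Vec n :=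
  Sum.elim (fun j : Fin m => P.gradC y j)
    (fun i => (EuclideanSpace.single (i : Fin n) (1 : ℝ) : Vec n))

open Classical in
-- The biorthogonal family gives explicit multipliers `μ k = ⟨v, b k⟩`, so no separation or Farkas
-- argument is needed.
theorem exists_multiplier_of_LICQ (hxu : ∀ i, 0 < P.xu i) (hc : ContDiff ℝ 1 P.c)
    {v y : Vec n} (hy : y ∈ P.feasible) (hL : P.LICQ y)
    (hopt : ∀ z ∈ P.feasible, (0 : ℝ) ≤ inner ℝ v (z - y)) :
    ∃ (lam : Fin m → ℝ) (zl zu : Vec n), P.IsMultiplier v y lam zl zu := by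
  obtain ⟨b, hb⟩ := exists_biorthogonal (a := P.activeGrad y y) hL
  have hsingle : ∀ (i : Fin n) (w : Vec n),
      (inner ℝ (EuclideanSpace.single i (1 : ℝ)) w : ℝ) = w i := by
    intro i w
    simp [EuclideanSpace.inner_single_left]
  -- Such a `w` is the velocity of a curve that is feasible for small `t > 0`: active components are
  -- affine in `t`, inactive bounds stay strict by continuity.
  have hdir : ∀ w : Vec n, (∀ j, (inner ℝ (P.gradC y j) w : ℝ) = 0) →
      (∀ i, y i = 0 → 0 ≤ w i) → (∀ i, y i = P.xu i → w i ≤ 0) → (0 : ℝ) ≤ inner ℝ v w := by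
    intro w h1 h2 h3
    obtain ⟨γ, hγd, hγ0, hγ⟩ := exists_curve
      (G := fun z => Sum.elim (P.c z) (fun i : {i : Fin n // y i = 0 ∨ y i = P.xu i} => z i))
      (x := y) (a := P.activeGrad y y) (by
        rintro (j | i)
        · simp only [Sum.elim_inl, innerSL_gradC]
          exact (contDiff_component hc j).contDiffAt.hasStrictFDerivAt one_ne_zero
        · simp only [Sum.elim_inr]
          have h := (innerSL ℝ (EuclideanSpace.single (i : Fin n) (1 : ℝ) : Vec n)).hasStrictFDerivAt
            (x := y)
          have e : (fun z : Vec n => z i) =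
              innerSL ℝ (EuclideanSpace.single (i : Fin n) (1 : ℝ) : Vec n) := by
            funext z
            rw [innerSL_apply_apply, hsingle]
          rw [e]
          exact h) hb w
    have hcoord : ∀ i, Tendsto (fun t => γ t i) (𝓝 0) (𝓝 (y i)) := by
      intro i
      have := hγd.continuousAt.tendsto
      rw [hγ0] at this
      exact ((PiLp.continuous_apply 2 _ i).tendsto y).comp this
    have hup : ∀ᶠ t in 𝓝 (0 : ℝ), ∀ i, y i < P.xu i → γ t i < P.xu i := by
      refine eventually_all.2 fun i => ?_
      by_cases h : y i < P.xu i
      · filter_upwards [(hcoord i).eventually (gt_mem_nhds h)] with t ht _ using ht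
      · exact Eventually.of_forall fun t h' => absurd h' h
    have hlo : ∀ᶠ t in 𝓝 (0 : ℝ), ∀ i, 0 < y i → 0 < γ t i := by
      refine eventually_all.2 fun i => ?_
      by_cases h : 0 < y i
      · filter_upwards [(hcoord i).eventually (lt_mem_nhds h)] with t ht _ using ht
      · exact Eventually.of_forall fun t h' => absurd h' h
    have hfeas : ∀ᶠ t in 𝓝[>] (0 : ℝ), γ t ∈ P.feasible := by
      filter_upwards [nhdsWithin_le_nhds hγ, nhdsWithin_le_nhds hup, nhdsWithin_le_nhds hlo,
        self_mem_nhdsWithin] with t e1 e2 e3 ht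
      have ht' : 0 < t := ht
      refine ⟨?_, fun i => ⟨?_, ?_⟩⟩
      · funext j
        have := e1 (Sum.inl j)
        simp only [Sum.elim_inl, h1 j, mul_zero, add_zero] at this
        rw [this, hy.1]
      · rcases (hy.2 i).1.eq_or_lt with h | h
        · have := e1 (Sum.inr ⟨i, Or.inl h.symm⟩)
          simp only [Sum.elim_inr, hsingle] at this
          rw [this, ← h, zero_add]
          exact mul_nonneg ht'.le (h2 i h.symm)
        · exact (e3 i h).le
      · rcases (hy.2 i).2.eq_or_lt with h | h
        · have := e1 (Sum.inr ⟨i, Or.inr h⟩)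
          simp only [Sum.elim_inr, hsingle] at this
          rw [this, ← h]
          nlinarith [h3 i h]
        · exact (e2 i h).le
    have hder : HasDerivAt (fun t => (inner ℝ v (γ t) : ℝ)) (inner ℝ v w) 0 := by
      exact (innerSL ℝ v).hasFDerivAt.comp_hasDerivAt (0 : ℝ) hγd
    refine ge_of_tendsto hder.tendsto_slope_zero_right ?_
    filter_upwards [hfeas, self_mem_nhdsWithin] with t h ht
    have ht' : 0 < t := ht
    have := hopt _ h
    rw [inner_sub_right] at this
    rw [zero_add, hγ0, smul_eq_mul]
    exact mul_nonneg (inv_nonneg.2 ht'.le) this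
  set μ : Fin m ⊕ {i : Fin n // y i = 0 ∨ y i = P.xu i} → ℝ := fun k => inner ℝ v (b k) with hμ
  have hlin : v = ∑ k, μ k • P.activeGrad y y k := by
    set u := v - ∑ k, μ k • P.activeGrad y y k with hu
    -- The correction makes `q` orthogonal to all active gradients, hence an admissible direction,
    -- and `⟨v, q⟩ = -‖u‖²`; so `u = 0`.
    set q := -u + ∑ k, (inner ℝ (P.activeGrad y y k) u : ℝ) • b k with hq
    have hq0 : ∀ k, (inner ℝ (P.activeGrad y y k) q : ℝ) = 0 := by
      intro k
      simp only [hq, inner_add_right, inner_neg_right, inner_sum, inner_smul_right, hb]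
      simp
    have hqi : ∀ i, y i = 0 ∨ y i = P.xu i → q i = 0 := by
      intro i hi
      have := hq0 (Sum.inr ⟨i, hi⟩)
      exact (hsingle i q).symm.trans this
    have h := hdir q (fun j => hq0 (Sum.inl j)) (fun i hi => (hqi i (Or.inl hi)).ge)
      (fun i hi => (hqi i (Or.inr hi)).le)
    have h' : (inner ℝ v q : ℝ) = -inner ℝ u u := by
      have e : (inner ℝ u u : ℝ) = inner ℝ v u - ∑ k, μ k * inner ℝ (P.activeGrad y y k) u := by
        conv_lhs => rw [hu]
        rw [← hu, inner_sub_left, sum_inner]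
        simp only [real_inner_smul_left]
      rw [e, hq, inner_add_right, inner_neg_right, inner_sum]
      simp only [inner_smul_right, hμ]
      rw [neg_sub, neg_add_eq_sub]
      congr 1
      exact Finset.sum_congr rfl fun k _ => mul_comm _ _
    rw [h', real_inner_self_eq_norm_sq] at h
    have hu0 : u = 0 := by
      rw [← norm_eq_zero]
      nlinarith [norm_nonneg u]
    exact sub_eq_zero.1 (hu.symm.trans hu0)
  have hbj : ∀ (i) (j : Fin m), (inner ℝ (P.gradC y j) (b (Sum.inr i)) : ℝ) = 0 := by
    intro i j
    have := hb (Sum.inl j) (Sum.inr i)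
    simpa using this
  have hbi : ∀ (i i' : {i : Fin n // y i = 0 ∨ y i = P.xu i}),
      b (Sum.inr i) (i' : Fin n) = if i' = i then 1 else 0 := by
    intro i i'
    have := hb (Sum.inr i') (Sum.inr i)
    refine (hsingle i' _).symm.trans (this.trans ?_)
    simp only [Sum.inr.injEq]
  have hne : ∀ i, y i = 0 → y i = P.xu i → False := fun i h h' => (hxu i).ne (h.symm.trans h')
  -- The vectors `b k` and `-b k` change only one active component, which gives the signs. Since `xu
  -- > 0`, no coordinate is active at both bounds.
  have hpos : ∀ i (h : y i = 0), 0 ≤ μ (Sum.inr ⟨i, Or.inl h⟩) := by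
    intro i h
    refine hdir _ (fun j => hbj _ j) (fun i' hi' => ?_) (fun i' hi' => ?_)
    · rw [hbi ⟨i, Or.inl h⟩ ⟨i', Or.inl hi'⟩]
      split_ifs <;> norm_num
    · rw [hbi ⟨i, Or.inl h⟩ ⟨i', Or.inr hi'⟩, if_neg]
      intro e
      have : i' = i := congrArg Subtype.val e
      subst this
      exact hne _ h hi'
  have hneg : ∀ i (h : y i = P.xu i), μ (Sum.inr ⟨i, Or.inr h⟩) ≤ 0 := by
    intro i h
    have := hdir (-b (Sum.inr ⟨i, Or.inr h⟩)) (fun j => by rw [inner_neg_right, hbj, neg_zero])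
      (fun i' hi' => ?_) (fun i' hi' => ?_)
    · rw [inner_neg_right] at this
      simp only [hμ]
      linarith
    · rw [PiLp.neg_apply, hbi ⟨i, Or.inr h⟩ ⟨i', Or.inl hi'⟩, if_neg, neg_zero]
      intro e
      have : i' = i := congrArg Subtype.val e
      subst this
      exact hne _ hi' h
    · rw [PiLp.neg_apply, hbi ⟨i, Or.inr h⟩ ⟨i', Or.inr hi'⟩]
      split_ifs <;> norm_num
  refine ⟨fun j => μ (Sum.inl j),
    WithLp.toLp 2 fun i => if h : y i = 0 then μ (Sum.inr ⟨i, Or.inl h⟩) else 0,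
    WithLp.toLp 2 fun i => if h : y i = P.xu i then -μ (Sum.inr ⟨i, Or.inr h⟩) else 0,
    hy, ?_, fun i => ⟨?_, ?_⟩, fun i => ⟨?_, ?_⟩⟩
  · conv_lhs => rw [hlin]
    rw [Fintype.sum_sum_type]
    simp only [Sum.elim_inl, Sum.elim_inr, add_sub_cancel_left]
    ext i
    have hs : (∑ k : {i : Fin n // y i = 0 ∨ y i = P.xu i},
        μ (Sum.inr k) • (EuclideanSpace.single (k : Fin n) (1 : ℝ) : Vec n)) i =
        if h : y i = 0 ∨ y i = P.xu i then μ (Sum.inr ⟨i, h⟩) else 0 := by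
      rw [WithLp.ofLp_sum, Finset.sum_apply]
      split_ifs with h
      · rw [Finset.sum_eq_single ⟨i, h⟩]
        · simp
        · intro k _ hk
          have : i ≠ k := fun e => hk (Subtype.ext e.symm)
          simp [this]
        · simp
      · refine Finset.sum_eq_zero fun k _ => ?_
        have : i ≠ k := fun e => h (e ▸ k.2)
        simp [this]
    simp only [PiLp.add_apply, PiLp.sub_apply, PiLp.zero_apply, hs]
    by_cases h1 : y i = 0
    · have h2 : ¬ y i = P.xu i := fun h => hne i h1 h
      rw [dif_pos (Or.inl h1), dif_pos h1, dif_neg h2]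
      ring
    · by_cases h2 : y i = P.xu i
      · rw [dif_pos (Or.inr h2), dif_neg h1, dif_pos h2]
        ring
      · rw [dif_neg (not_or.2 ⟨h1, h2⟩), dif_neg h1, dif_neg h2]
        ring
  · dsimp only
    split_ifs with h
    exacts [hpos i h, le_rfl]
  · dsimp only
    split_ifs with h
    exacts [neg_nonneg.2 (hneg i h), le_rfl]
  · dsimp only
    split_ifs with h
    · exact mul_eq_zero_of_right _ h
    · rw [zero_mul]
  · dsimp only
    split_ifs with h
    · exact mul_eq_zero_of_right _ (sub_eq_zero.2 h)
    · rw [zero_mul]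

theorem eventually_active_imp (P : Problem n m) (x : Vec n) :
    ∀ᶠ y : Vec n in 𝓝 x, ∀ i, y i = 0 ∨ y i = P.xu i → x i = 0 ∨ x i = P.xu i := by
  refine eventually_all.2 fun i => ?_
  have hcont : Tendsto (fun y : Vec n => y i) (𝓝 x) (𝓝 (x i)) :=
    (PiLp.continuous_apply 2 _ i).tendsto x
  by_cases h : x i = 0 ∨ x i = P.xu i
  · exact Eventually.of_forall fun _ _ => h
  · push Not at h
    filter_upwards [hcont.eventually_ne h.1, hcont.eventually_ne h.2] with y h1 h2 h3
    exact absurd h3 (by tauto)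

theorem continuous_activeGrad (hc : ContDiff ℝ 1 P.c) (x : Vec n) :
    Continuous (P.activeGrad x) := by
  refine continuous_pi ?_
  rintro (j | i)
  · exact continuous_gradC hc j
  · exact continuous_const

/-- Linear independence is open for the family with active set frozen at `x`, and the active set can
only shrink nearby, leaving a subfamily. -/
theorem LICQ.eventually (hc : ContDiff ℝ 1 P.c) {x : Vec n} (hL : P.LICQ x) :
    ∀ᶠ y in 𝓝 x, P.LICQ y := by
  have hL' : LinearIndependent ℝ (P.activeGrad x x) := hL
  have h1 : ∀ᶠ y in 𝓝 x, LinearIndependent ℝ (P.activeGrad x y) :=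
    ((continuous_activeGrad hc x).tendsto x).eventually
      (isOpen_setOfPred_linearIndependent.mem_nhds hL')
  filter_upwards [h1, eventually_active_imp P x] with y hy hact
  have := hy.comp (Sum.map id (fun i : {i : Fin n // y i = 0 ∨ y i = P.xu i} =>
      (⟨i, hact i i.2⟩ : {i : Fin n // x i = 0 ∨ x i = P.xu i})))
    (Function.Injective.sumMap Function.injective_id fun i i' h =>
      Subtype.ext (Subtype.mk.inj h))
  refine Eq.mp ?_ this
  unfold LICQ
  congr 1
  funext k
  rcases k with j | i <;> rfl

/-- Near a point at which the constraint qualification holds, multipliers are bounded by the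
gradient of the objective. -/
theorem LICQ.exists_multiplier_bound (hxu : ∀ i, 0 < P.xu i) (hc : ContDiff ℝ 1 P.c)
    {x : Vec n} (hL : P.LICQ x) :
    ∃ C : ℝ, 0 ≤ C ∧ ∀ᶠ y in 𝓝 x, ∀ (v : Vec n) (lam : Fin m → ℝ) (zl zu : Vec n),
      P.IsMultiplier v y lam zl zu →
      ‖lam‖ ≤ C * ‖v‖ ∧ ‖zl‖ ≤ n * (C * ‖v‖) ∧ ‖zu‖ ≤ n * (C * ‖v‖) := by
  classical
  have hL' : LinearIndependent ℝ (P.activeGrad x x) := hL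
  obtain ⟨K, hK0, hK⟩ := LinearMap.exists_antilipschitzWith
    (Fintype.linearCombination ℝ (P.activeGrad x x))
    (LinearMap.ker_eq_bot.2 hL'.fintypeLinearCombination_injective)
  have hK0' : (0 : ℝ) < K := hK0
  have hbound : ∀ q : Fin m ⊕ {i : Fin n // x i = 0 ∨ x i = P.xu i} → ℝ,
      ‖q‖ ≤ K * ‖∑ k, q k • P.activeGrad x x k‖ := by
    intro q
    have := hK.le_mul_dist q 0
    simpa [Fintype.linearCombination_apply] using this
  have hcont : Tendsto (fun y => ∑ j, ‖P.gradC x j - P.gradC y j‖) (𝓝 x) (𝓝 0) := by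
    have : Continuous (fun y => ∑ j, ‖P.gradC x j - P.gradC y j‖) :=
      continuous_finsetSum _ fun j _ => (continuous_const.sub (continuous_gradC hc j)).norm
    simpa using this.tendsto x
  -- Replacing the gradients at `y` by those at `x` costs at most `‖q‖ / 2` when their total
  -- variation is below `1/(2K)`; absorbing this on the left doubles `K`.
  refine ⟨2 * K, by positivity, ?_⟩
  filter_upwards [hcont.eventually (gt_mem_nhds (show 0 < 1 / (2 * (K : ℝ)) by positivity)),
    eventually_active_imp P x] with y hy hact v lam zl zu ⟨hyF, hstat, hsign, hcomp⟩
  have hone : ∀ i, zl i = 0 ∨ zu i = 0 := by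
    intro i
    by_contra! h
    have h1 := (mul_eq_zero.1 (hcomp i).1).resolve_left h.1
    have h2 := (mul_eq_zero.1 (hcomp i).2).resolve_left h.2
    linarith [hxu i]
  -- By `hone` the difference loses nothing: in each coordinate it is either `zl` or `-zu`.
  set μ : Vec n := zl - zu with hμ
  have hμact : ∀ i, ¬ (x i = 0 ∨ x i = P.xu i) → μ i = 0 := by
    intro i hi
    have h1 : ¬ (y i = 0 ∨ y i = P.xu i) := fun h => hi (hact i h)
    push Not at h1
    have h2 := (mul_eq_zero.1 (hcomp i).1).resolve_right h1.1
    have h3 := (mul_eq_zero.1 (hcomp i).2).resolve_right (sub_ne_zero.2 h1.2)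
    simp [hμ, h2, h3]
  set q : Fin m ⊕ {i : Fin n // x i = 0 ∨ x i = P.xu i} → ℝ :=
    Sum.elim lam (fun i => μ i) with hq
  have hμsum : ∑ i : {i : Fin n // x i = 0 ∨ x i = P.xu i},
      μ i • (EuclideanSpace.single (i : Fin n) (1 : ℝ) : Vec n) = μ := by
    ext i
    rw [WithLp.ofLp_sum, Finset.sum_apply]
    by_cases h : x i = 0 ∨ x i = P.xu i
    · rw [Finset.sum_eq_single ⟨i, h⟩]
      · simp
      · intro k _ hk
        have : i ≠ k := fun e => hk (Subtype.ext e.symm)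
        simp [this]
      · simp
    · rw [hμact i h]
      refine Finset.sum_eq_zero fun k _ => ?_
      have : i ≠ k := fun e => h (e ▸ k.2)
      simp [this]
  have hv : v = ∑ j, lam j • P.gradC y j + μ := by
    rw [hμ]
    have : v - (∑ j, lam j • P.gradC y j + (zl - zu)) = 0 := by
      rw [← hstat]; abel
    exact sub_eq_zero.1 this
  have hsum : ∑ k, q k • P.activeGrad x x k =
      v + ∑ j, lam j • (P.gradC x j - P.gradC y j) := by
    rw [Fintype.sum_sum_type]
    simp only [hq, Sum.elim_inl, Sum.elim_inr, hμsum, smul_sub, Finset.sum_sub_distrib]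
    rw [hv]
    abel
  have hlamq : ∀ j, |lam j| ≤ ‖q‖ := fun j => norm_le_pi_norm q (Sum.inl j)
  have hq1 : ‖q‖ ≤ 2 * K * ‖v‖ := by
    have h1 := hbound q
    rw [hsum] at h1
    have h2 : ‖∑ j, lam j • (P.gradC x j - P.gradC y j)‖ ≤ ‖q‖ * (1 / (2 * K)) := by
      calc _ ≤ ∑ j, ‖lam j • (P.gradC x j - P.gradC y j)‖ := norm_sum_le _ _
        _ ≤ ∑ j, ‖q‖ * ‖P.gradC x j - P.gradC y j‖ := by
            refine Finset.sum_le_sum fun j _ => ?_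
            rw [norm_smul]
            exact mul_le_mul_of_nonneg_right (hlamq j) (norm_nonneg _)
        _ = ‖q‖ * ∑ j, ‖P.gradC x j - P.gradC y j‖ := by rw [Finset.mul_sum]
        _ ≤ _ := mul_le_mul_of_nonneg_left hy.le (norm_nonneg _)
    have h3 : ‖q‖ ≤ K * (‖v‖ + ‖q‖ * (1 / (2 * K))) :=
      h1.trans (mul_le_mul_of_nonneg_left ((norm_add_le _ _).trans (by gcongr)) hK0'.le)
    have h4 : (K : ℝ) * (‖v‖ + ‖q‖ * (1 / (2 * K))) = K * ‖v‖ + ‖q‖ / 2 := by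
      field_simp
    linarith
  have hμq : ∀ i, |μ i| ≤ 2 * K * ‖v‖ := by
    intro i
    by_cases h : x i = 0 ∨ x i = P.xu i
    · exact (norm_le_pi_norm q (Sum.inr ⟨i, h⟩)).trans hq1
    · rw [hμact i h, abs_zero]
      positivity
  refine ⟨(pi_norm_le_iff_of_nonneg (by positivity)).2 fun j => (hlamq j).trans hq1,
    norm_le_card_mul fun i => ?_, norm_le_card_mul fun i => ?_⟩
  · rcases hone i with h | h
    · rw [h, abs_zero]; positivity
    · have := hμq i
      rwa [hμ, PiLp.sub_apply, h, sub_zero] at this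
  · rcases hone i with h | h
    · have := hμq i
      rwa [hμ, PiLp.sub_apply, h, zero_sub, abs_neg] at this
    · rw [h, abs_zero]; positivity

end Problem

/-! ### The subproblem: well-posedness and first-order optimality. -/

namespace Problem

variable {n m : ℕ} {P : Problem n m}

theorem isClosed_feasible (hc : ContDiff ℝ 1 P.c) : IsClosed P.feasible := by
  have h : P.feasible = {x | P.c x = 0} ∩ ⋂ i, ({x | 0 ≤ x i} ∩ {x | x i ≤ P.xu i}) := by
    ext x
    simp [feasible]
  rw [h]
  have hi : ∀ i : Fin n, Continuous fun x : Vec n => x i := fun i =>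
    PiLp.continuous_apply 2 _ i
  exact (isClosed_eq hc.continuous continuous_const).inter (isClosed_iInter fun i =>
    (isClosed_le continuous_const (hi i)).inter (isClosed_le (hi i) continuous_const))

theorem isCompact_feasible (hc : ContDiff ℝ 1 P.c) (hbdd : Bornology.IsBounded P.feasible) :
    IsCompact P.feasible :=
  Metric.isCompact_of_isClosed_isBounded (isClosed_feasible hc) hbdd

/-- The quadratic model equals its second-order expansion at `z + d`. Together with the variational
inequality, the remainder yields both uniqueness and the predicted decrease. -/
theorem model_sub_model (z g d y : Vec n) (a : ℝ) :
    P.model z g a y - P.model z g a (z + d) =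
      inner ℝ (g + a • d) (y - (z + d)) + a / 2 * ‖y - (z + d)‖ ^ 2 := by
  obtain ⟨e, rfl⟩ : ∃ e, y = z + d + e := ⟨y - (z + d), by abel⟩
  have h1 : z + d + e - z = d + e := by abel
  simp only [model, add_sub_cancel_left, h1, inner_add_left, inner_add_right,
    real_inner_smul_left, norm_add_sq_real]
  ring

theorem predicted_eq (z g d : Vec n) (a : ℝ) :
    P.predicted z g a d = -inner ℝ g d - a / 2 * ‖d‖ ^ 2 := by
  simp [predicted, model]
  ring

/-- First-order optimality of the solution of a subproblem over a convex feasible set. -/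
theorem SolvesSubproblem.variational (hconv : Convex ℝ P.feasible) {z g d : Vec n} {a : ℝ}
    (h : P.SolvesSubproblem z g a d) {y : Vec n} (hy : y ∈ P.feasible) :
    (0 : ℝ) ≤ inner ℝ (g + a • d) (y - (z + d)) := by
  set e := y - (z + d) with he
  have hlim : Tendsto (fun t : ℝ => (inner ℝ (g + a • d) e : ℝ) + a / 2 * (t * ‖e‖ ^ 2)) (𝓝[>] 0)
      (𝓝 (inner ℝ (g + a • d) e + a / 2 * (0 * ‖e‖ ^ 2))) := by
    refine Tendsto.mono_left ?_ nhdsWithin_le_nhds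
    exact ((continuous_const.add (continuous_const.mul (continuous_id.mul continuous_const)))
      : Continuous fun t : ℝ =>
        (inner ℝ (g + a • d) e : ℝ) + a / 2 * (t * ‖e‖ ^ 2)).tendsto 0
  rw [zero_mul, mul_zero, add_zero] at hlim
  refine ge_of_tendsto hlim ?_
  filter_upwards [Ioc_mem_nhdsGT (zero_lt_one' ℝ)] with t ht
  have hmem : z + d + t • e ∈ P.feasible := by
    have := hconv.add_smul_sub_mem h.1 hy ⟨ht.1.le, ht.2⟩
    exact this
  have h1 := h.2 hmem
  have h2 := model_sub_model (P := P) z g d (z + d + t • e) a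
  rw [add_sub_cancel_left, inner_smul_right, norm_smul, Real.norm_eq_abs, abs_of_pos ht.1] at h2
  have h3 : 0 ≤ t * (inner ℝ (g + a • d) e + a / 2 * (t * ‖e‖ ^ 2)) := by
    simp only [mem_ofPred_eq] at h1
    nlinarith
  exact nonneg_of_mul_nonneg_right h3 ht.1

theorem existsUnique_solvesSubproblem (hF : IsCompact P.feasible) (hconv : Convex ℝ P.feasible)
    (hne : P.feasible.Nonempty) (z g : Vec n) {a : ℝ} (ha : 0 < a) :
    ∃! d : Vec n, P.SolvesSubproblem z g a d := by
  have hcont : Continuous (P.model z g a) := by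
    unfold model
    fun_prop
  obtain ⟨y, hy, hmin⟩ := hF.exists_isMinOn hne hcont.continuousOn
  have hzy : z + (y - z) = y := by abel
  refine ⟨y - z, ⟨by rwa [hzy], by rwa [hzy]⟩, fun d hd => ?_⟩
  have h1 := hmin hd.1
  have h2 := hd.variational hconv hy
  have h3 := model_sub_model (P := P) z g d y a
  simp only [mem_ofPred_eq] at h1
  have h4 : ‖y - (z + d)‖ ^ 2 ≤ 0 := by nlinarith
  have h5 : y - (z + d) = 0 := by
    rw [← norm_eq_zero]
    exact pow_eq_zero_iff two_ne_zero |>.1 (le_antisymm h4 (sq_nonneg _))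
  rw [sub_eq_zero.1 h5]
  abel

/-- A feasible centre is itself a competitor in the variational inequality. -/
theorem SolvesSubproblem.le_predicted (hconv : Convex ℝ P.feasible) {z g d : Vec n} {a : ℝ}
    (h : P.SolvesSubproblem z g a d) (hz : z ∈ P.feasible) :
    a / 2 * ‖d‖ ^ 2 ≤ P.predicted z g a d := by
  have h1 := h.variational hconv hz
  have h2 := model_sub_model (P := P) z g d z a
  have h3 : ‖z - (z + d)‖ = ‖d‖ := by rw [sub_add_cancel_left, norm_neg]
  rw [predicted, h2, h3]
  linarith

theorem SolvesSubproblem.exists_multiplier (hxu : ∀ i, 0 < P.xu i) (hc : ContDiff ℝ 1 P.c)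
    (hconv : Convex ℝ P.feasible) {z g d : Vec n} {a : ℝ}
    (h : P.SolvesSubproblem z g a d) (hL : P.LICQ (z + d)) :
    ∃ (lam : Fin m → ℝ) (zl zu : Vec n), P.IsSubproblemMultiplier z g a d lam zl zu :=
  exists_multiplier_of_LICQ hxu hc h.1 hL fun _ hy => h.variational hconv hy

end Problem

/-! ### Acceptance of trial steps. -/

section Acceptance

variable {n m : ℕ} {P : Problem n m} {A : Params}

theorem Accepted.sufficient_decrease (hconv : Convex ℝ P.feasible) {z g d : Vec n} {a : ℝ}
    (ha : A.alpha0 ≤ a) (h : P.SolvesSubproblem z g a d) (hz : z ∈ P.feasible)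
    (hacc : Accepted P A z g a d) :
    A.etaLp * A.alpha0 / 2 * ‖d‖ ^ 2 < P.r z - P.r (z + d) := by
  have h1 := h.le_predicted hconv hz
  have ha0 := A.alpha0_pos.trans_le ha
  have h2 : 0 ≤ P.predicted z g a d := le_trans (by positivity) h1
  have h3 := hacc.1
  rw [Problem.ratio, if_pos h2] at h3
  have h4 : A.etaLp * (A.alpha0 / 2 * ‖d‖ ^ 2) ≤ A.etaLp * P.predicted z g a d := by
    refine mul_le_mul_of_nonneg_left (le_trans ?_ h1) A.etaLp_pos.le
    gcongr
  linarith

/-- From a feasible centre, a nonzero step is accepted as soon as the quadratic coefficient exceeds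
the constant of the quadratic upper bound. -/
theorem accepted_of_feasible (hconv : Convex ℝ P.feasible) {z g d : Vec n} {a R : ℝ} (ha : 0 < a)
    (h : P.SolvesSubproblem z g a d) (hz : z ∈ P.feasible) (hd : d ≠ 0) (hRa : R < a)
    (hR : P.r (z + d) ≤ P.r z + inner ℝ g d + R / 2 * ‖d‖ ^ 2) :
    Accepted P A z g a d := by
  have h1 := h.le_predicted hconv hz
  have h2 : 0 ≤ P.predicted z g a d := le_trans (by positivity) h1
  have hpos : 0 < (a - R) * ‖d‖ ^ 2 :=
    mul_pos (sub_pos.2 hRa) (pow_pos (norm_pos_iff.2 hd) 2)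
  -- For `a > R` the actual decrease exceeds the nonnegative predicted one, and factors at most `1`
  -- only weaken the two tests.
  have h3 : P.predicted z g a d < P.r z - P.r (z + d) := by
    rw [Problem.predicted_eq]
    linarith
  have h4 := mul_le_mul_of_nonneg_right A.etaLp_le h2
  have h5 := mul_le_mul_of_nonneg_right A.etaGp_le h2
  unfold Accepted Problem.ratio
  rw [if_pos h2, if_pos h2]
  constructor <;> linarith

/-- From an infeasible centre, every step is accepted once the quadratic coefficient is large. -/
theorem exists_accepted_of_not_feasible (hF : IsCompact P.feasible)
    (hr : ContinuousOn P.r P.feasible) {z : Vec n} (hz : z ∉ P.feasible)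
    {K : NNReal} {U : Set (Vec n)} (hU : U ∈ 𝓝 z) (hK : LipschitzOnWith K P.r U) :
    ∃ R : ℝ, ∀ (a : ℝ) (g d : Vec n), 0 < a → R < a → g ∈ clarkeSubdiff P.r z →
      P.SolvesSubproblem z g a d → Accepted P A z g a d := by
  obtain ⟨D, hD⟩ := hF.isBounded.exists_norm_le
  obtain ⟨B, hB⟩ := hF.exists_bound_of_continuousOn hr
  obtain ⟨ε, hε, hball⟩ := Metric.isOpen_iff.1 hF.isClosed.isOpen_compl z hz
  -- Since `‖d‖ ≥ ε`, this threshold forces `δ < -(|r z| + B)`. As `η⁻ ≥ 1`, the term `-η⁻ δ` then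
  -- outweighs `|r z - r (z + d)|`.
  refine ⟨2 * (K * (D + ‖z‖) + |P.r z| + B) / ε ^ 2, fun a g d ha hRa hg h => ?_⟩
  have hdε : ε ≤ ‖d‖ := by
    by_contra! hlt
    have hmem : z + d ∈ Metric.ball z ε := by
      rwa [Metric.mem_ball, dist_eq_norm, add_sub_cancel_left]
    exact hball hmem h.1
  have hdD : ‖d‖ ≤ D + ‖z‖ := by
    have := norm_sub_le (z + d) z
    rw [add_sub_cancel_left] at this
    linarith [hD _ h.1]
  have hgK := norm_le_of_mem_clarkeSubdiff hU hK hg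
  have h1 : -inner ℝ g d ≤ (K : ℝ) * (D + ‖z‖) := by
    have h2 := (abs_le.1 (abs_real_inner_le_norm g d)).1
    have h3 : ‖g‖ * ‖d‖ ≤ K * (D + ‖z‖) := by gcongr
    linarith
  have h2 : a * ε ^ 2 ≤ a * ‖d‖ ^ 2 := by gcongr
  have h3 := (div_lt_iff₀ (pow_pos hε 2)).1 hRa
  have h4 := abs_le.1 (hB _ h.1)
  have h5 := neg_abs_le (P.r z)
  have h6 := abs_nonneg (P.r z)
  have hpred : P.predicted z g a d < -(|P.r z| + B) := by
    rw [Problem.predicted_eq]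
    linarith
  have hneg : P.predicted z g a d < 0 := by linarith
  unfold Accepted Problem.ratio
  rw [if_neg hneg.not_ge, if_neg hneg.not_ge]
  have h7 := mul_le_mul_of_nonpos_right A.etaLm_ge hneg.le
  have h8 := mul_le_mul_of_nonpos_right A.etaGm_ge hneg.le
  constructor <;> linarith

end Acceptance

/-! ### Compactness: bounded subgradients, and LICQ along a sequence. -/

section Bounds

variable {n : ℕ} {r : Vec n → ℝ}

/-- Clarke subgradients of a locally Lipschitz function are bounded on compact sets. -/
theorem exists_clarkeSubdiff_bound {O F : Set (Vec n)} (hO : IsOpen O) (hFO : F ⊆ O)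
    (hF : IsCompact F) (hLip : LocallyLipschitzOn O r) :
    ∃ K : ℝ, ∀ x ∈ F, ∀ g ∈ clarkeSubdiff r x, ‖g‖ ≤ K := by
  refine hF.induction_on (p := fun S => ∃ K : ℝ, ∀ x ∈ S, ∀ g ∈ clarkeSubdiff r x, ‖g‖ ≤ K)
    ⟨0, by simp⟩ ?_ ?_ ?_
  · rintro s t hst ⟨K, hK⟩
    exact ⟨K, fun x hx => hK x (hst hx)⟩
  · rintro s t ⟨K, hK⟩ ⟨K', hK'⟩
    refine ⟨max K K', ?_⟩
    rintro x (hx | hx) g hg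
    · exact (hK x hx g hg).trans (le_max_left _ _)
    · exact (hK' x hx g hg).trans (le_max_right _ _)
  · intro x hx
    obtain ⟨K, U, hU, hK⟩ := hLip (hFO hx)
    rw [hO.nhdsWithin_eq (hFO hx)] at hU
    refine ⟨interior U, mem_nhdsWithin_of_mem_nhds (interior_mem_nhds.2 hU), K, ?_⟩
    exact fun y hy g hg => norm_le_of_mem_clarkeSubdiff (mem_interior_iff_mem_nhds.1 hy) hK hg

theorem exists_tendsto_of_ultrafilter {ι E : Type*} [NormedAddCommGroup E] [ProperSpace E]
    (l : Ultrafilter ι) {f : ι → E} {M : ℝ} (h : ∀ᶠ k in (l : Filter ι), ‖f k‖ ≤ M) :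
    ∃ a, Tendsto f l (𝓝 a) := by
  obtain ⟨a, -, ha⟩ := (isCompact_closedBall (0 : E) M).ultrafilter_le_nhds (l.map f) (by
    rw [Ultrafilter.coe_map, le_principal_iff, mem_map]
    filter_upwards [h] with k hk
    simpa using hk)
  exact ⟨a, ha⟩

end Bounds

namespace Problem

variable {n m : ℕ} {P : Problem n m}

/-- If the constraint qualification holds at the accumulation points of a sequence in the compact
feasible set, then it holds eventually along the sequence, with multipliers bounded linearly in the
gradient of the objective. -/
theorem eventually_LICQ_and_bound (hxu : ∀ i, 0 < P.xu i)
    (hc : ContDiff ℝ 1 P.c) (hF : IsCompact P.feasible) {y : ℕ → Vec n}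
    (hy : ∀ᶠ k in atTop, y k ∈ P.feasible)
    (hL : ∀ xbar : Vec n, MapClusterPt xbar atTop y → P.LICQ xbar) :
    ∃ C : ℝ, 0 ≤ C ∧ ∀ᶠ k in atTop, P.LICQ (y k) ∧
      ∀ (v : Vec n) (lam : Fin m → ℝ) (zl zu : Vec n), P.IsMultiplier v (y k) lam zl zu →
        ‖lam‖ ≤ C * ‖v‖ ∧ ‖zl‖ ≤ n * (C * ‖v‖) ∧ ‖zu‖ ≤ n * (C * ‖v‖) := by
  have key := hF.induction_on (p := fun S => ∃ C : ℝ, 0 ≤ C ∧ ∀ᶠ k in atTop, y k ∈ S →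
      P.LICQ (y k) ∧
      ∀ (v : Vec n) (lam : Fin m → ℝ) (zl zu : Vec n), P.IsMultiplier v (y k) lam zl zu →
        ‖lam‖ ≤ C * ‖v‖ ∧ ‖zl‖ ≤ n * (C * ‖v‖) ∧ ‖zu‖ ≤ n * (C * ‖v‖))
    ⟨0, le_rfl, by simp⟩ ?_ ?_ ?_
  · obtain ⟨C, hC, h⟩ := key
    refine ⟨C, hC, ?_⟩
    filter_upwards [h, hy] with k h1 h2 using h1 h2
  · rintro s t hst ⟨C, hC, h⟩
    refine ⟨C, hC, ?_⟩
    filter_upwards [h] with k h1 h2 using h1 (hst h2)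
  · rintro s t ⟨C, hC, h⟩ ⟨C', hC', h'⟩
    refine ⟨max C C', hC.trans (le_max_left _ _), ?_⟩
    filter_upwards [h, h'] with k h1 h2 h3
    rcases h3 with h3 | h3
    · refine ⟨(h1 h3).1, fun v lam zl zu hm => ?_⟩
      obtain ⟨e1, e2, e3⟩ := (h1 h3).2 v lam zl zu hm
      have hle : C * ‖v‖ ≤ max C C' * ‖v‖ := by gcongr; exact le_max_left _ _
      exact ⟨e1.trans hle, e2.trans (by gcongr), e3.trans (by gcongr)⟩
    · refine ⟨(h2 h3).1, fun v lam zl zu hm => ?_⟩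
      obtain ⟨e1, e2, e3⟩ := (h2 h3).2 v lam zl zu hm
      have hle : C' * ‖v‖ ≤ max C C' * ‖v‖ := by gcongr; exact le_max_right _ _
      exact ⟨e1.trans hle, e2.trans (by gcongr), e3.trans (by gcongr)⟩
  · intro z _
    -- Near a cluster point LICQ does the work; any other point has a neighbourhood that the
    -- sequence eventually avoids, where the claim is vacuous.
    by_cases hz : MapClusterPt z atTop y
    · obtain ⟨C, hC, h⟩ := (hL z hz).exists_multiplier_bound hxu hc
      refine ⟨_, mem_nhdsWithin_of_mem_nhds (((hL z hz).eventually hc).and h), C, hC, ?_⟩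
      exact Eventually.of_forall fun k hk => hk
    · rw [mapClusterPt_iff_frequently] at hz
      push Not at hz
      obtain ⟨s, hs, h⟩ := hz
      refine ⟨s, mem_nhdsWithin_of_mem_nhds hs, 0, le_rfl, ?_⟩
      filter_upwards [h] with k h1 h2 using absurd h2 h1

end Problem

/-! ### Runs of the algorithm and their limits. -/

namespace IsRun

variable {n m : ℕ} {P : Problem n m} {A : Params} {N : ℕ∞} {x g d : ℕ → Vec n} {α : ℕ → ℝ}

theorem alpha_le_succ (h : IsRun P A N x g d α) {k : ℕ} (hk : (k : ℕ∞) < N) (hα : 0 ≤ α k) :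
    α k ≤ α (k + 1) := by
  by_cases hacc : Accepted P A (x k) (g k) (α k) (d k)
  · exact (h.serious k hk hacc).2.ge
  · rw [(h.reject k hk hacc).2]
    nlinarith [A.etaA_gt]

theorem lt_of_succ_le {k : ℕ} (hk : ((k + 1 : ℕ) : ℕ∞) ≤ N) : (k : ℕ∞) < N :=
  lt_of_lt_of_le (by exact_mod_cast Nat.lt_succ_self k) hk

theorem alpha0_le (h : IsRun P A N x g d α) : ∀ k : ℕ, (k : ℕ∞) ≤ N → A.alpha0 ≤ α k := by
  intro k
  induction k with
  | zero => exact fun _ => h.init.ge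
  | succ k ih =>
    intro hk
    have hk' := lt_of_succ_le hk
    have h1 := ih hk'.le
    exact h1.trans (h.alpha_le_succ hk' (A.alpha0_pos.le.trans h1))

theorem alpha_pos (h : IsRun P A N x g d α) {k : ℕ} (hk : (k : ℕ∞) ≤ N) : 0 < α k :=
  A.alpha0_pos.trans_le (h.alpha0_le k hk)

theorem succ_mem_or_eq (h : IsRun P A N x g d α) {k : ℕ} (hk : (k : ℕ∞) < N) :
    x (k + 1) ∈ P.feasible ∨ x (k + 1) = x k := by
  by_cases hacc : Accepted P A (x k) (g k) (α k) (d k)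
  · rw [(h.serious k hk hacc).1]
    exact Or.inl (h.solves k hk.le).1
  · exact Or.inr (h.reject k hk hacc).1

/-- Only one centre can be infeasible, so a single extra threshold suffices in
`exists_alpha_threshold`. -/
theorem mem_or_eq_init (h : IsRun P A N x g d α) :
    ∀ k : ℕ, (k : ℕ∞) ≤ N → x k ∈ P.feasible ∨ x k = x 0 := by
  intro k
  induction k with
  | zero => exact fun _ => Or.inr rfl
  | succ k ih =>
    intro hk
    have hk' := lt_of_succ_le hk
    rcases h.succ_mem_or_eq hk' with h1 | h1
    · exact Or.inl h1
    · rw [h1]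
      exact ih hk'.le

theorem feasible_after_serious (h : IsRun P A N x g d α) {k : ℕ} (hk : (k : ℕ∞) < N)
    (hacc : Accepted P A (x k) (g k) (α k) (d k)) :
    ∀ j : ℕ, k < j → (j : ℕ∞) ≤ N → x j ∈ P.feasible := by
  intro j hj
  induction j, hj using Nat.le_induction with
  | base =>
    intro _
    rw [(h.serious k hk hacc).1]
    exact (h.solves k hk.le).1
  | succ j _ ih =>
    intro hjN
    have hj' := lt_of_succ_le hjN
    rcases h.succ_mem_or_eq hj' with h1 | h1
    · exact h1
    · rw [h1]
      exact ih hj'.le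

/-- The penalty term vanishes at both feasible ends, so `θ` is immaterial; `α k ≥ α₀` makes the
constant uniform. -/
theorem merit_decrease (hconv : Convex ℝ P.feasible) (h : IsRun P A N x g d α) (θ : ℝ) {k : ℕ}
    (hk : (k : ℕ∞) < N) (hacc : Accepted P A (x k) (g k) (α k) (d k))
    (hx : x k ∈ P.feasible) :
    A.etaLp * A.alpha0 / 2 * ‖d k‖ ^ 2 < P.merit θ (x k) - P.merit θ (x (k + 1)) := by
  have h1 := hacc.sufficient_decrease hconv (h.alpha0_le k hk.le) (h.solves k hk.le) hx
  have h2 := (h.solves k hk.le).1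
  rw [(h.serious k hk hacc).1]
  simpa [Problem.merit, hx.1, h2.1] using h1

theorem isKKT_of_step_eq_zero (hxu : ∀ i, 0 < P.xu i) (hc : ContDiff ℝ 1 P.c)
    (hconv : Convex ℝ P.feasible) (h : IsRun P A N x g d α) {k : ℕ} (hk : (k : ℕ∞) ≤ N)
    (hd : d k = 0)
    (hL : P.LICQ (x k) ∨ ∃ (lam : Fin m → ℝ) (zl zu : Vec n),
      P.IsSubproblemMultiplier (x k) (g k) (α k) (d k) lam zl zu) : P.IsKKT (x k) := by
  have hex : ∃ (lam : Fin m → ℝ) (zl zu : Vec n),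
      P.IsSubproblemMultiplier (x k) (g k) (α k) (d k) lam zl zu := by
    rcases hL with hL | hL
    · exact (h.solves k hk).exists_multiplier hxu hc hconv (by rwa [hd, add_zero])
    · exact hL
  obtain ⟨lam, zl, zu, hm⟩ := hex
  rw [Problem.IsSubproblemMultiplier, hd, smul_zero, add_zero, add_zero] at hm
  exact ⟨g k, h.subgrad k hk, lam, zl, zu, hm⟩

/-- Steps are accepted once the quadratic coefficient exceeds a constant. -/
theorem exists_alpha_threshold {O : Set (Vec n)} (hO : IsOpen O) (hFO : P.feasible ⊆ O)
    (hF : IsCompact P.feasible) (hconv : Convex ℝ P.feasible)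
    (hLip : LocallyLipschitzOn O P.r) (hC2 : UpperC2On P.r O) (hx0 : x 0 ∈ O)
    (h : IsRun P A ⊤ x g d α) :
    ∃ R : ℝ, ∀ k, R < α k → Accepted P A (x k) (g k) (α k) (d k) := by
  obtain ⟨R, hR⟩ := exists_uniform_quadratic_bound hO hFO hF hLip hC2
  have hfeas : ∀ k, R < α k → x k ∈ P.feasible → Accepted P A (x k) (g k) (α k) (d k) := by
    intro k hk hx
    have hs := h.solves k le_top
    refine accepted_of_feasible hconv (h.alpha_pos le_top) hs hx ?_ hk ?_
    -- A run that continues has `d k ≠ 0` even when `ε = 0`.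
    · exact norm_pos_iff.1 (A.eps_nonneg.trans_lt (h.proceed k (WithTop.coe_lt_top k)))
    · simpa using hR _ hx _ hs.1 _ (h.subgrad k le_top)
  by_cases hx0F : x 0 ∈ P.feasible
  · refine ⟨R, fun k hk => hfeas k hk ?_⟩
    rcases h.mem_or_eq_init k le_top with h1 | h1
    · exact h1
    · rwa [h1]
  · obtain ⟨K, U, hU, hK⟩ := hLip hx0
    rw [hO.nhdsWithin_eq hx0] at hU
    obtain ⟨R', hR'⟩ := exists_accepted_of_not_feasible (A := A) hF (hLip.continuousOn.mono hFO)
      hx0F hU hK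
    refine ⟨max R R', fun k hk => ?_⟩
    rcases h.mem_or_eq_init k le_top with h1 | h1
    · exact hfeas k ((le_max_left _ _).trans_lt hk) h1
    · have hs := h.solves k le_top
      have hg := h.subgrad k le_top
      rw [h1] at hs hg ⊢
      exact hR' _ _ _ (h.alpha_pos le_top) ((le_max_right _ _).trans_lt hk) hg hs

theorem monotone_alpha (h : IsRun P A ⊤ x g d α) : Monotone α :=
  monotone_nat_of_le_succ fun k =>
    h.alpha_le_succ (WithTop.coe_lt_top k) (h.alpha_pos le_top).le

/-- Infinitely many rejections would make `α` grow geometrically past `R`, after which none can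
occur. -/
theorem eventually_accepted (h : IsRun P A ⊤ x g d α) {R : ℝ}
    (hR : ∀ k, R < α k → Accepted P A (x k) (g k) (α k) (d k)) :
    ∃ K, ∀ k, K ≤ k → Accepted P A (x k) (g k) (α k) (d k) := by
  by_contra! hcon
  have hgrow : ∀ j : ℕ, ∃ k, A.alpha0 * A.etaA ^ j ≤ α k := by
    intro j
    induction j with
    | zero => exact ⟨0, by simp [h.init]⟩
    | succ j ih =>
      obtain ⟨k, hk⟩ := ih
      obtain ⟨k', hkk', hrej⟩ := hcon k
      refine ⟨k' + 1, ?_⟩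
      rw [(h.reject k' (WithTop.coe_lt_top k') hrej).2]
      have h1 := hk.trans (h.monotone_alpha hkk')
      have h2 := mul_le_mul_of_nonneg_left h1 (zero_le_one.trans A.etaA_gt.le)
      calc A.alpha0 * A.etaA ^ (j + 1) = A.etaA * (A.alpha0 * A.etaA ^ j) := by ring
        _ ≤ _ := h2
  obtain ⟨j, hj⟩ := pow_unbounded_of_one_lt (R / A.alpha0) A.etaA_gt
  obtain ⟨k, hk⟩ := hgrow j
  obtain ⟨k', hkk', hrej⟩ := hcon k
  refine hrej (hR k' ?_)
  have h1 := (div_lt_iff₀ A.alpha0_pos).1 hj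
  have h2 := h.monotone_alpha hkk'
  linarith

/-- The values `r (x k)` decrease and are bounded below, so their differences, which dominate a
multiple of `‖d k‖²`, vanish. -/
theorem tendsto_step (hconv : Convex ℝ P.feasible) (hF : IsCompact P.feasible)
    (hr : ContinuousOn P.r P.feasible) (h : IsRun P A ⊤ x g d α) {K : ℕ}
    (hacc : ∀ k, K ≤ k → Accepted P A (x k) (g k) (α k) (d k))
    (hx : ∀ k, K ≤ k → x k ∈ P.feasible) : Tendsto d atTop (𝓝 0) := by
  set c := A.etaLp * A.alpha0 / 2 with hc
  have hcpos : 0 < c := by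
    have := A.etaLp_pos
    have := A.alpha0_pos
    positivity
  have hdec : ∀ k, c * ‖d (k + K)‖ ^ 2 ≤ P.r (x (k + K)) - P.r (x (k + 1 + K)) := by
    intro k
    have hk : K ≤ k + K := Nat.le_add_left _ _
    have h1 := (hacc _ hk).sufficient_decrease hconv (h.alpha0_le _ le_top) (h.solves _ le_top)
      (hx _ hk)
    rw [← (h.serious _ (WithTop.coe_lt_top _) (hacc _ hk)).1] at h1
    rw [show k + 1 + K = k + K + 1 by ring]
    exact h1.le
  have hanti : Antitone fun k => P.r (x (k + K)) :=
    antitone_nat_of_succ_le fun k => by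
      have : 0 ≤ c * ‖d (k + K)‖ ^ 2 := by positivity
      linarith [hdec k]
  obtain ⟨B, hB⟩ := hF.exists_bound_of_continuousOn hr
  have hbdd : BddBelow (range fun k => P.r (x (k + K))) := by
    refine ⟨-B, ?_⟩
    rintro _ ⟨k, rfl⟩
    exact (abs_le.1 (hB _ (hx _ (Nat.le_add_left _ _)))).1
  have hlim := tendsto_atTop_ciInf hanti hbdd
  have hdiff : Tendsto (fun k => P.r (x (k + K)) - P.r (x (k + 1 + K))) atTop (𝓝 0) := by
    have := hlim.sub (hlim.comp (tendsto_add_atTop_nat 1))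
    rwa [sub_self] at this
  have hsq : Tendsto (fun k => c * ‖d (k + K)‖ ^ 2) atTop (𝓝 0) :=
    squeeze_zero (fun k => by positivity) hdec hdiff
  have hsq' : Tendsto (fun k => ‖d (k + K)‖ ^ 2) atTop (𝓝 0) := by
    have := hsq.const_mul c⁻¹
    simp only [mul_zero] at this
    refine this.congr fun k => ?_
    field_simp
  have hnorm : Tendsto (fun k => ‖d (k + K)‖) atTop (𝓝 0) := by
    have := hsq'.sqrt
    simpa [Real.sqrt_sq] using this
  exact (tendsto_add_atTop_iff_nat K).1 (tendsto_zero_iff_norm_tendsto_zero.2 hnorm)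

theorem exists_multiplier_bound (hxu : ∀ i, 0 < P.xu i) (hc : ContDiff ℝ 1 P.c)
    (hconv : Convex ℝ P.feasible) (hF : IsCompact P.feasible)
    {O : Set (Vec n)} (hO : IsOpen O) (hFO : P.feasible ⊆ O) (hLip : LocallyLipschitzOn O P.r)
    (h : IsRun P A ⊤ x g d α) {K : ℕ} (hα : ∀ k, K ≤ k → α k = α K)
    (hx : ∀ k, K ≤ k → x k ∈ P.feasible) (hxd : ∀ k, K ≤ k → x (k + 1) = x k + d k)
    (hd : Tendsto d atTop (𝓝 0))
    (hL : ∀ xbar : Vec n, MapClusterPt xbar atTop x → P.LICQ xbar) :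
    ∃ (K' : ℕ) (M : ℝ), ∀ k : ℕ, K' ≤ k →
      (∃ (lam : Fin m → ℝ) (zl zu : Vec n),
        P.IsSubproblemMultiplier (x k) (g k) (α k) (d k) lam zl zu) ∧
      ∀ (lam : Fin m → ℝ) (zl zu : Vec n),
        P.IsSubproblemMultiplier (x k) (g k) (α k) (d k) lam zl zu →
        ‖lam‖ ≤ M ∧ ‖zl‖ ≤ M ∧ ‖zu‖ ≤ M := by
  have hxF : ∀ᶠ k in atTop, x k ∈ P.feasible := (eventually_ge_atTop K).mono hx
  obtain ⟨C, hC, hev⟩ := Problem.eventually_LICQ_and_bound hxu hc hF hxF hL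
  obtain ⟨G, hG⟩ := exists_clarkeSubdiff_bound hO hFO hF hLip
  have hαd : Tendsto (fun k => ‖α K • d k‖) atTop (𝓝 0) := by
    simpa using (hd.const_smul (α K)).norm
  -- The multipliers of subproblem `k` live at `x k + d k = x (k + 1)`, hence the shift.
  have hev' := (tendsto_add_atTop_nat 1).eventually hev
  have hfin : ∀ᶠ k in atTop, (∃ (lam : Fin m → ℝ) (zl zu : Vec n),
        P.IsSubproblemMultiplier (x k) (g k) (α k) (d k) lam zl zu) ∧
      ∀ (lam : Fin m → ℝ) (zl zu : Vec n),
        P.IsSubproblemMultiplier (x k) (g k) (α k) (d k) lam zl zu →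
        ‖lam‖ ≤ (1 + n) * (C * (G + 1)) ∧ ‖zl‖ ≤ (1 + n) * (C * (G + 1)) ∧
          ‖zu‖ ≤ (1 + n) * (C * (G + 1)) := by
    filter_upwards [hev', eventually_ge_atTop K, hαd.eventually (gt_mem_nhds zero_lt_one)]
      with k hk hKk hk1
    rw [hxd k hKk] at hk
    refine ⟨(h.solves k le_top).exists_multiplier hxu hc hconv hk.1, fun lam zl zu hm => ?_⟩
    obtain ⟨e1, e2, e3⟩ := hk.2 _ lam zl zu hm
    have hv : ‖g k + α k • d k‖ ≤ G + 1 := by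
      rw [hα k hKk]
      exact (norm_add_le _ _).trans (add_le_add (hG _ (hx k hKk) _ (h.subgrad k le_top)) hk1.le)
    have hCv : C * ‖g k + α k • d k‖ ≤ C * (G + 1) := by gcongr
    have h0 : 0 ≤ C * ‖g k + α k • d k‖ := by positivity
    have hn : (0 : ℝ) ≤ n := Nat.cast_nonneg n
    refine ⟨?_, ?_, ?_⟩ <;> nlinarith
  obtain ⟨K', hK'⟩ := eventually_atTop.1 hfin
  exact ⟨K', _, hK'⟩

/-- Accumulation points of an infinite run with bounded multipliers are KKT points. -/
theorem isKKT_of_mapClusterPt (hc : ContDiff ℝ 1 P.c) (hF : IsCompact P.feasible)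
    {O : Set (Vec n)} (hO : IsOpen O) (hFO : P.feasible ⊆ O) (hLip : LocallyLipschitzOn O P.r)
    (h : IsRun P A ⊤ x g d α) {K : ℕ} (hα : ∀ k, K ≤ k → α k = α K)
    (hx : ∀ k, K ≤ k → x k ∈ P.feasible)
    (hd : Tendsto d atTop (𝓝 0)) {K' : ℕ} {M : ℝ}
    (hM : ∀ k : ℕ, K' ≤ k →
      (∃ (lam : Fin m → ℝ) (zl zu : Vec n),
        P.IsSubproblemMultiplier (x k) (g k) (α k) (d k) lam zl zu) ∧
      ∀ (lam : Fin m → ℝ) (zl zu : Vec n),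
        P.IsSubproblemMultiplier (x k) (g k) (α k) (d k) lam zl zu →
        ‖lam‖ ≤ M ∧ ‖zl‖ ≤ M ∧ ‖zu‖ ≤ M)
    {xbar : Vec n} (hxbar : MapClusterPt xbar atTop x) : P.IsKKT xbar := by
  -- Along an ultrafilter every bounded sequence converges, so subgradients and multipliers get
  -- limits together, without nested subsequences.
  obtain ⟨l, hl, hxl⟩ := mapClusterPt_iff_ultrafilter.1 hxbar
  have hex : ∀ k, ∃ (lam : Fin m → ℝ) (zl zu : Vec n), K' ≤ k →
      P.IsSubproblemMultiplier (x k) (g k) (α k) (d k) lam zl zu := by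
    intro k
    by_cases hk : K' ≤ k
    · obtain ⟨lam, zl, zu, hm⟩ := (hM k hk).1
      exact ⟨lam, zl, zu, fun _ => hm⟩
    · exact ⟨0, 0, 0, fun hk' => absurd hk' hk⟩
  choose lam zl zu hm using hex
  have hK : ∀ᶠ k in (l : Filter ℕ), K ≤ k := hl (eventually_ge_atTop K)
  have hK' : ∀ᶠ k in (l : Filter ℕ), K' ≤ k := hl (eventually_ge_atTop K')
  have hmul : ∀ᶠ k in (l : Filter ℕ),
      P.IsSubproblemMultiplier (x k) (g k) (α k) (d k) (lam k) (zl k) (zu k) :=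
    hK'.mono fun k hk => hm k hk
  have hbd : ∀ᶠ k in (l : Filter ℕ), ‖lam k‖ ≤ M ∧ ‖zl k‖ ≤ M ∧ ‖zu k‖ ≤ M :=
    hK'.mono fun k hk => (hM k hk).2 _ _ _ (hm k hk)
  obtain ⟨G, hG⟩ := exists_clarkeSubdiff_bound hO hFO hF hLip
  obtain ⟨gb, hgb⟩ := exists_tendsto_of_ultrafilter l (f := g) (M := G)
    (hK.mono fun k hk => hG _ (hx k hk) _ (h.subgrad k le_top))
  obtain ⟨lb, hlb⟩ := exists_tendsto_of_ultrafilter l (hbd.mono fun k hk => hk.1)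
  obtain ⟨zlb, hzlb⟩ := exists_tendsto_of_ultrafilter l (hbd.mono fun k hk => hk.2.1)
  obtain ⟨zub, hzub⟩ := exists_tendsto_of_ultrafilter l (hbd.mono fun k hk => hk.2.2)
  have hxF : xbar ∈ P.feasible := hF.isClosed.mem_of_tendsto hxl (hK.mono hx)
  have hdl : Tendsto d l (𝓝 0) := hd.mono_left hl
  have hyl : Tendsto (fun k => x k + d k) l (𝓝 xbar) := by
    simpa using hxl.add hdl
  have hvl : Tendsto (fun k => g k + α k • d k) l (𝓝 gb) := by
    have h1 := hgb.add (hdl.const_smul (α K))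
    rw [smul_zero, add_zero] at h1
    refine h1.congr' (hK.mono fun k hk => ?_)
    simp only [hα k hk]
  have hcoord : ∀ {f : ℕ → Vec n} {z : Vec n} (i : Fin n), Tendsto f l (𝓝 z) →
      Tendsto (fun k => f k i) l (𝓝 (z i)) := fun i hf =>
    ((PiLp.continuous_apply 2 _ i).tendsto _).comp hf
  obtain ⟨Lc, U, hU, hLc⟩ := hLip (hFO hxF)
  rw [hO.nhdsWithin_eq (hFO hxF)] at hU
  refine ⟨gb, mem_clarkeSubdiff_of_tendsto hU hLc hxl hgb
    (Eventually.of_forall fun k => h.subgrad k le_top), lb, zlb, zub, hxF, ?_,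
    fun i => ⟨?_, ?_⟩, fun i => ⟨?_, ?_⟩⟩
  · have h1 : Tendsto (fun k => (g k + α k • d k) - ∑ j, lam k j • P.gradC (x k + d k) j - zl k
        + zu k) l (𝓝 (gb - ∑ j, lb j • P.gradC xbar j - zlb + zub)) := by
      refine ((hvl.sub (tendsto_finsetSum _ fun j _ => ?_)).sub hzlb).add hzub
      exact ((tendsto_pi_nhds.1 hlb) j).smul
        (((Problem.continuous_gradC hc j).tendsto xbar).comp hyl)
    exact tendsto_nhds_unique h1
      (tendsto_const_nhds.congr' (hmul.mono fun k hk => hk.2.1.symm))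
  · exact ge_of_tendsto (hcoord i hzlb) (hmul.mono fun k hk => (hk.2.2.1 i).1)
  · exact ge_of_tendsto (hcoord i hzub) (hmul.mono fun k hk => (hk.2.2.1 i).2)
  · exact tendsto_nhds_unique ((hcoord i hzlb).mul (hcoord i hyl))
      (tendsto_const_nhds.congr' (hmul.mono fun k hk => (hk.2.2.2 i).1.symm))
  · exact tendsto_nhds_unique ((hcoord i hzub).mul ((hcoord i hyl).sub_const (P.xu i)))
      (tendsto_const_nhds.congr' (hmul.mono fun k hk => (hk.2.2.2 i).2.symm))

end IsRun

/-- A sequence that is eventually given by running maxima of a sequence that is eventually bounded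
above converges. -/
theorem exists_tendsto_of_eventually_max {θ b : ℕ → ℝ} {B : ℝ}
    (hb : ∀ᶠ k in atTop, b k ≤ B) (hθ : ∀ᶠ k in atTop, θ (k + 1) = max (θ k) (b k)) :
    ∃ θbar : ℝ, Tendsto θ atTop (𝓝 θbar) := by
  obtain ⟨K, hK⟩ := eventually_atTop.1 (hb.and hθ)
  have hrec : ∀ k, θ (k + 1 + K) = max (θ (k + K)) (b (k + K)) := fun k => by
    rw [show k + 1 + K = k + K + 1 by ring]
    exact (hK _ (Nat.le_add_left _ _)).2
  have hmono : Monotone fun k => θ (k + K) :=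
    monotone_nat_of_le_succ fun k => by
      rw [hrec k]
      exact le_max_left _ _
  have hbdd : BddAbove (range fun k => θ (k + K)) := by
    refine ⟨max (θ K) B, ?_⟩
    rintro _ ⟨k, rfl⟩
    induction k with
    | zero => simp
    | succ k ih =>
      simp only [hrec k]
      exact max_le ih ((hK _ (Nat.le_add_left _ _)).1.trans (le_max_right _ _))
  exact ⟨_, (tendsto_add_atTop_iff_nat K).1 (tendsto_atTop_ciSup hmono hbdd)⟩

end SimplifiedBundle

/-! ### Assembly of the theorem. -/

theorem mainTheorem10 {n m : ℕ} (P : SimplifiedBundle.Problem n m)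
    (hxu : ∀ i, 0 < P.xu i)
    (hc : ContDiff ℝ 1 P.c)
    (hconv : Convex ℝ P.feasible) (hbdd : Bornology.IsBounded P.feasible)
    (O : Set (SimplifiedBundle.Vec n)) (hO : IsOpen O) (hFO : P.feasible ⊆ O)
    (hLip : LocallyLipschitzOn O P.r) (hC2 : SimplifiedBundle.UpperC2On P.r O)
    (A : SimplifiedBundle.Params) :
    -- the subproblems are well posed
    (P.feasible.Nonempty → ∀ (z g : SimplifiedBundle.Vec n) (a : ℝ), 0 < a →
      ∃! d : SimplifiedBundle.Vec n, P.SolvesSubproblem z g a d) ∧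
    ∀ (N : ℕ∞) (x g d : ℕ → SimplifiedBundle.Vec n) (α : ℕ → ℝ),
      x 0 ∈ O → SimplifiedBundle.IsRun P A N x g d α →
      -- after the first serious step all iterates are feasible
      (∀ k : ℕ, (k : ℕ∞) < N → SimplifiedBundle.Accepted P A (x k) (g k) (α k) (d k) →
        ∀ j : ℕ, k < j → (j : ℕ∞) ≤ N → x j ∈ P.feasible) ∧
      -- sufficient decrease of the merit function at serious steps
      (∃ cφ : ℝ, 0 < cφ ∧ ∀ (θ : ℝ) (k : ℕ), (k : ℕ∞) < N →
        SimplifiedBundle.Accepted P A (x k) (g k) (α k) (d k) → x k ∈ P.feasible →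
        cφ * ‖d k‖ ^ 2 < P.merit θ (x k) - P.merit θ (x (k + 1))) ∧
      -- termination with a zero step happens at a KKT point
      (∀ k : ℕ, (k : ℕ∞) = N → d k = 0 →
        (P.LICQ (x k) ∨ ∃ (lam : Fin m → ℝ) (zl zu : SimplifiedBundle.Vec n),
          P.IsSubproblemMultiplier (x k) (g k) (α k) (d k) lam zl zu) →
        P.IsKKT (x k)) ∧
      -- a positive tolerance forces termination
      (0 < A.eps → N ≠ ⊤) ∧
      -- infinite runs
      (N = ⊤ →
        -- finitely many rejected steps; the quadratic coefficient is eventually constant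
        {k : ℕ | ¬ SimplifiedBundle.Accepted P A (x k) (g k) (α k) (d k)}.Finite ∧
        (∃ K : ℕ, ∀ k : ℕ, K ≤ k → α k = α K) ∧
        -- the steps tend to zero, and accumulation points exist
        Filter.Tendsto d Filter.atTop (nhds 0) ∧
        (∃ xbar : SimplifiedBundle.Vec n, MapClusterPt xbar Filter.atTop x) ∧
        -- under LICQ at the accumulation points
        ((∀ xbar : SimplifiedBundle.Vec n, MapClusterPt xbar Filter.atTop x → P.LICQ xbar) →
          -- the subproblem multipliers eventually exist and are bounded
          (∃ (K : ℕ) (M : ℝ), ∀ k : ℕ, K ≤ k →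
            (∃ (lam : Fin m → ℝ) (zl zu : SimplifiedBundle.Vec n),
              P.IsSubproblemMultiplier (x k) (g k) (α k) (d k) lam zl zu) ∧
            ∀ (lam : Fin m → ℝ) (zl zu : SimplifiedBundle.Vec n),
              P.IsSubproblemMultiplier (x k) (g k) (α k) (d k) lam zl zu →
              ‖lam‖ ≤ M ∧ ‖zl‖ ≤ M ∧ ‖zu‖ ≤ M) ∧
          -- the penalty parameters that they generate converge
          (∀ (γ : ℝ) (lam : ℕ → Fin m → ℝ) (zl zu : ℕ → SimplifiedBundle.Vec n) (θ : ℕ → ℝ),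
            (∀ᶠ k in Filter.atTop,
              P.IsSubproblemMultiplier (x k) (g k) (α k) (d k) (lam k) (zl k) (zu k)) →
            (∀ᶠ k in Filter.atTop,
              θ (k + 1) = max (θ k) (A.etaGm * ‖lam (k + 1)‖ + γ)) →
            ∃ θbar : ℝ, Filter.Tendsto θ Filter.atTop (nhds θbar)) ∧
          -- every accumulation point is a KKT point
          (∀ xbar : SimplifiedBundle.Vec n, MapClusterPt xbar Filter.atTop x →
            P.IsKKT xbar))) := by
  have hF := SimplifiedBundle.Problem.isCompact_feasible hc hbdd
  have hr : ContinuousOn P.r P.feasible := hLip.continuousOn.mono hFO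
  have hinf : ∀ (x g d : ℕ → SimplifiedBundle.Vec n) (α : ℕ → ℝ), x 0 ∈ O →
      SimplifiedBundle.IsRun P A ⊤ x g d α →
      ∃ K : ℕ, (∀ k, K ≤ k → SimplifiedBundle.Accepted P A (x k) (g k) (α k) (d k)) ∧
        (∀ k, K ≤ k → α k = α K) ∧ (∀ k, K ≤ k → x k ∈ P.feasible) ∧
        (∀ k, K ≤ k → x (k + 1) = x k + d k) ∧ Tendsto d atTop (𝓝 0) := by
    intro x g d α hx0 h
    obtain ⟨R, hR⟩ := h.exists_alpha_threshold hO hFO hF hconv hLip hC2 hx0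
    obtain ⟨K, hK⟩ := h.eventually_accepted hR
    -- Step `K` is serious but may start from an infeasible point; feasibility is guaranteed from `K
    -- + 1` on.
    have hacc : ∀ k, K + 1 ≤ k → SimplifiedBundle.Accepted P A (x k) (g k) (α k) (d k) :=
      fun k hk => hK k (by lia)
    have hx : ∀ k, K + 1 ≤ k → x k ∈ P.feasible := fun k hk =>
      h.feasible_after_serious (WithTop.coe_lt_top K) (hK K le_rfl) k hk le_top
    refine ⟨K + 1, hacc, fun k hk => ?_, hx,
      fun k hk => (h.serious k (WithTop.coe_lt_top k) (hacc k hk)).1,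
      h.tendsto_step hconv hF hr hacc hx⟩
    induction k, hk using Nat.le_induction with
    | base => rfl
    | succ k hk ih => rw [(h.serious k (WithTop.coe_lt_top k) (hacc k hk)).2, ih]
  refine ⟨fun hne z g a ha =>
    SimplifiedBundle.Problem.existsUnique_solvesSubproblem hF hconv hne z g ha, ?_⟩
  intro N x g d α hx0 h
  refine ⟨fun k hk hacc => h.feasible_after_serious hk hacc,
    ⟨A.etaLp * A.alpha0 / 2, half_pos (mul_pos A.etaLp_pos A.alpha0_pos),
      fun θ k hk hacc hx => h.merit_decrease hconv θ hk hacc hx⟩,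
    fun k hk hd hL => h.isKKT_of_step_eq_zero hxu hc hconv hk.le hd hL, ?_, ?_⟩
  · rintro heps rfl
    obtain ⟨K, -, -, -, -, hd⟩ := hinf x g d α hx0 h
    obtain ⟨k, hk⟩ := (hd.norm.eventually (gt_mem_nhds (by simpa using heps))).exists
    exact (h.proceed k (WithTop.coe_lt_top k)).not_gt hk
  · rintro rfl
    obtain ⟨K, hacc, hα, hx, hxd, hd⟩ := hinf x g d α hx0 h
    refine ⟨?_, ⟨K, hα⟩, hd, ?_, fun hL => ?_⟩
    · refine (Set.finite_lt_nat K).subset fun k hk => ?_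
      by_contra hlt
      exact hk (hacc k (not_lt.1 hlt))
    · obtain ⟨xbar, -, hxbar⟩ := hF.exists_mapClusterPt_of_frequently (f := x) (l := atTop)
        ((eventually_ge_atTop K).mono hx).frequently
      exact ⟨xbar, hxbar⟩
    · obtain ⟨K', M, hM⟩ :=
        h.exists_multiplier_bound hxu hc hconv hF hO hFO hLip hα hx hxd hd hL
      refine ⟨⟨K', M, hM⟩, fun γ lam zl zu θ hlam hθ => ?_, fun xbar hxbar =>
        h.isKKT_of_mapClusterPt hc hF hO hFO hLip hα hx hd hM hxbar⟩
      refine SimplifiedBundle.exists_tendsto_of_eventually_max (B := A.etaGm * M + γ) ?_ hθ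
      -- The recursion for `θ (k + 1)` uses `lam (k + 1)`, so the multiplier bound is shifted by
      -- one.
      refine (tendsto_add_atTop_nat 1).eventually
        (p := fun k => A.etaGm * ‖lam k‖ + γ ≤ A.etaGm * M + γ) ?_
      filter_upwards [hlam, eventually_ge_atTop K'] with k h1 h2
      have h3 := ((hM k h2).2 _ _ _ h1).1
      have h4 := zero_le_one.trans A.etaGm_ge
      gcongr
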